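/- Let $p$ be a prime and let $G$ be a finite group with a normal Sylow $p$-subgroup $P$. For a complex irreducible character $\chi$ of $G$, let $\mathbb{Q}(\chi)$ be the field generated over $\mathbb{Q}$ by the values of $\chi$, let $c(\chi)$ be the smallest positive integer $n$ such that $\mathbb{Q}(\chi)$ is contained in the field $\mathbb{Q}_n$ generated over $\mathbb{Q}$ by a primitive $n$-th root of unity, and let the $p$-rationality level of $\chi$ be the integer $\alpha\ge 0$ such that $p^\alpha$ is the exact power of $p$ dividing $c(\chi)$. Let $\Phi(P)$ be the Frattini subgroup of $P$, and put $K=G/\Phi(P)$ and $Q=P/\Phi(P)\le K$. Then the following are equivalent: (i) No irreducible character of $G$ of degree not divisible by $p$ has $p$-rationality level $1$. (ii) For every $1\neq y\in Q$: (a) $N_K(\langle y\rangle)/C_K(y)\cong\operatorname{Aut}(\langle y\rangle)$, and (b) $N_K(\langle y\rangle)/Q$ acts trivially (by conjugation) on the set of conjugacy classes of $C_K(y)/Q$. -/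

import Mathlib

/-! ### Irreducible characters and their conductors -/

/-- `χ : G → ℂ` is a complex irreducible character of `G`: the character of an irreducible
representation of `G` on some `ℂⁿ`. -/
def IsIrrChar {G : Type*} [Group G] (χ : G → ℂ) : Prop :=
  ∃ (n : ℕ) (ρ : Representation ℂ G (Fin n → ℂ)), ρ.IsIrreducible ∧ ρ.character = χ

/-- The set of irreducible characters of `G` whose degree `χ(1)` is not divisible by `p`. -/
def IrrPrimeDegree (p : ℕ) (G : Type*) [Group G] : Set (G → ℂ) :=
  {χ | IsIrrChar χ ∧ ∃ d : ℕ, χ 1 = (d : ℂ) ∧ ¬ p ∣ d}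

/-- The field of values `ℚ(χ)`, the subfield of `ℂ` generated by the values of `χ`. -/
noncomputable def fieldOfValues {G : Type*} (χ : G → ℂ) : IntermediateField ℚ ℂ :=
  IntermediateField.adjoin ℚ (Set.range χ)

/-- The cyclotomic field `ℚₙ`, the subfield of `ℂ` generated by a primitive `n`-th root of unity
(equivalently, by all of them). -/
noncomputable def cyclotomicSubfield (n : ℕ) : IntermediateField ℚ ℂ :=
  IntermediateField.adjoin ℚ {ζ : ℂ | IsPrimitiveRoot ζ n}

/-- The conductor of an abelian number field `F ⊆ ℂ`: the smallest positive integer `n` with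
`F ⊆ ℚₙ`. -/
noncomputable def fieldConductor (F : IntermediateField ℚ ℂ) : ℕ :=
  sInf {n : ℕ | 0 < n ∧ F ≤ cyclotomicSubfield n}

/-- The conductor `c(χ)`. -/
noncomputable def charConductor {G : Type*} (χ : G → ℂ) : ℕ :=
  fieldConductor (fieldOfValues χ)

/-- The `p`-rationality level of `χ`: the exponent `α` such that `p ^ α` is the exact power of `p`
dividing `c(χ)`. -/
noncomputable def pRationalityLevel (p : ℕ) {G : Type*} (χ : G → ℂ) : ℕ :=
  padicValNat p (charConductor χ)

/-! ### The groups `Φ(P)`, `K = G/Φ(P)` and `Q = P/Φ(P)` -/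

/-- The Frattini subgroup `Φ(P)` of a subgroup `P` of `G`, as a subgroup of `G`. -/
def frattiniIn {G : Type*} [Group G] (P : Subgroup G) : Subgroup G :=
  (frattini P).map P.subtype

instance frattiniIn_normal {G : Type*} [Group G] (P : Subgroup G) [P.Normal] :
    (frattiniIn P).Normal := by
  unfold frattiniIn; infer_instance

/-- `P/Φ(P)` as a subgroup of `G/Φ(P)`, for `P` normal in `G`. -/
def frattiniQuotient {G : Type*} [Group G] (P : Subgroup G) [P.Normal] :
    Subgroup (G ⧸ frattiniIn P) :=
  P.map (QuotientGroup.mk' (frattiniIn P))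

instance frattiniQuotient_normal {G : Type*} [Group G] (P : Subgroup G) [P.Normal] :
    (frattiniQuotient P).Normal :=
  Subgroup.Normal.map inferInstance _ (QuotientGroup.mk'_surjective _)

/-! ### Normalizers and centralizers of cyclic subgroups -/

/-- `N_K(⟨y⟩)`. -/
def normalizerZPowers {K : Type*} [Group K] (y : K) : Subgroup K :=
  Subgroup.normalizer (Subgroup.zpowers y : Set K)

/-- `C_K(y)`. -/
def centralizerOf {K : Type*} [Group K] (y : K) : Subgroup K :=
  Subgroup.centralizer {y}

theorem centralizerOf_eq {K : Type*} [Group K] (y : K) :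
    centralizerOf y = Subgroup.centralizer (Subgroup.zpowers y : Set K) := by
  rw [centralizerOf, Subgroup.zpowers_eq_closure, Subgroup.centralizer_closure]

instance centralizerOf_normal {K : Type*} [Group K] (y : K) :
    ((centralizerOf y).subgroupOf (normalizerZPowers y)).Normal := by
  rw [centralizerOf_eq, normalizerZPowers]; infer_instance

/-! ### The conjugation action on conjugacy classes -/

/-- The action of `Aut(B)` on the set of conjugacy classes of `B`. -/
def autConjClasses (B : Type*) [Group B] : MulAut B →* Equiv.Perm (ConjClasses B) where
  toFun φ :=
    { toFun := ConjClasses.map φ.toMonoidHom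
      invFun := ConjClasses.map φ.symm.toMonoidHom
      left_inv := by rintro ⟨b⟩; exact congrArg ConjClasses.mk (φ.symm_apply_apply b)
      right_inv := by rintro ⟨b⟩; exact congrArg ConjClasses.mk (φ.apply_symm_apply b) }
  map_one' := by ext ⟨b⟩; rfl
  map_mul' φ ψ := by ext ⟨b⟩; rfl

/-- If `A` normalizes `B`, the action of `A` by conjugation on the set of conjugacy classes
of `B`. -/
def conjClassesAction {L : Type*} [Group L] (A B : Subgroup L)
    (h : A ≤ Subgroup.normalizer (B : Set L)) : A →* Equiv.Perm (ConjClasses B) :=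
  (autConjClasses B).comp (B.normalizerMonoidHom.comp (Subgroup.inclusion h))

/-- For `Q` normal in `K`, the quotient `N_K(⟨y⟩)/Q` (more precisely the image of `N_K(⟨y⟩)` in
`K/Q`) normalizes the image `C_K(y)/Q` of `C_K(y)`. -/
theorem map_normalizerZPowers_le {K : Type*} [Group K] (Q : Subgroup K) [Q.Normal] (y : K) :
    (normalizerZPowers y).map (QuotientGroup.mk' Q) ≤
      Subgroup.normalizer
        ((centralizerOf y).map (QuotientGroup.mk' Q) : Set (K ⧸ Q)) := by
  have hle : centralizerOf y ≤ normalizerZPowers y := by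
    rw [centralizerOf_eq]; exact Subgroup.centralizer_le_normalizer _
  have h1 : normalizerZPowers y ≤ Subgroup.normalizer (centralizerOf y : Set K) :=
    (Subgroup.normal_subgroupOf_iff_le_normalizer hle).1 inferInstance
  exact (Subgroup.map_mono h1).trans (Subgroup.le_normalizer_map _)

/-- `N_K(⟨y⟩)/Q` acts trivially, by conjugation, on the set of conjugacy classes of `C_K(y)/Q`.
Both quotients are taken inside `K/Q`; this is used for `Q` abelian and normal in `K` and `y ∈ Q`,
so that `Q ≤ C_K(y) ≤ N_K(⟨y⟩)`. -/
def ActsTriviallyOnClasses {K : Type*} [Group K] (Q : Subgroup K) [Q.Normal] (y : K) : Prop :=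
  ∀ (a : (normalizerZPowers y).map (QuotientGroup.mk' Q))
    (κ : ConjClasses ((centralizerOf y).map (QuotientGroup.mk' Q))),
    conjClassesAction _ _ (map_normalizerZPowers_le Q y) a κ = κ

/-!
Write `m` for the index of `P`, `N = Φ(P)`, `K = G/N` and `Q = P/N`, an elementary abelian normal
Sylow subgroup of `K`. Both conditions of the theorem are shown to be equivalent to

(*) every `g ∈ K` is conjugate to `g ^ u` for all `u` prime to `p` with `u ≡ 1` modulo `m`.

From (*) to (ii): decompose `g = y x` with `y ∈ Q` and `x` of order prime to `p`. Then (*) says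
that for commuting `y` and `x`, the elements centralizing `x` conjugate `y` to every generator of
`⟨y⟩` (`forall_isConj_pow_iff`). For `x = 1` this is (a). In general it is (b) on top of (a),
since elements of order prime to `p` in the same coset of `Q` are `Q`-conjugate, by an averaging
argument (`exists_conj_eq_of_coprime`, `forall_conj_pow_iff_forall_mulAut`).

From (*) to (i): a Galois automorphism raising roots of unity to the power `u` sends `χ(g)` to
`χ(g ^ u)`, since on the powers of `g` a character is a sum of powers of roots of unity. Hence the
values of `χ` lie in `ℚ_d` if and only if `χ(g ^ u) = χ(g)` whenever `u ≡ 1` modulo `d`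
(`fieldOfValues_le_cyclotomicSubfield_iff`). As `ℚ_a ∩ ℚ_b = ℚ_(a,b)`, the level of `χ` is `1` if
and only if its values lie in `ℚ_{pm}` but not in `ℚ_m` (`pRationalityLevel_eq_one_iff`).

* If `χ` has degree prime to `p` and values in `ℚ_{pm}`, then it is trivial on `Φ(P)`
  (`Representation.IsIrreducible.eq_one_of_mem_frattiniIn`): its restriction to `P` contains a
  linear character, so `P'` acts trivially, and the power map `x ↦ x ^ (1 + p)` permutes the
  weights of `P/P'` with multiplicities through a permutation of `p`-power order. The sum of the
  multiplicities is prime to `p`, so some weight is fixed. Such a weight has order dividing `p`,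
  and its kernel contains `Φ(P)`. Thus (*) excludes level `1`.
* Conversely every irreducible character of `K` has degree prime to `p`, by Clifford theory for
  the complemented abelian normal subgroup `Q` (`Representation.IsIrreducible.not_dvd_finrank`),
  and its values lie in `ℚ_{pm}`. If none has level `1`, then all are constant on the powers in
  (*), and (*) follows because the irreducible characters separate conjugacy classes
  (`Representation.isConj_of_forall_isIrrChar`).

The argument is uniform in `p`; for `p = 2` both conditions always hold.
-/

/-! ### Conjugating elements to their powers -/

/-- If `Q` is an abelian normal subgroup of exponent dividing `p`, then two elements of the same
coset of `Q` whose orders divide a number `m` prime to `p` are conjugate under `Q`. -/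
theorem exists_conj_eq_of_coprime {K : Type*} [Group K] {Q : Subgroup K} [Q.Normal]
    (hc : ∀ a ∈ Q, ∀ b ∈ Q, a * b = b * a) {p m : ℕ} (hp : 1 < p) (hpm : m.Coprime p)
    (hQ : ∀ q ∈ Q, q ^ p = 1) {x x' : K} (hx : x ^ m = 1) (hx' : x' ^ m = 1)
    (h : x' * x⁻¹ ∈ Q) : ∃ w ∈ Q, w * x * w⁻¹ = x' := by
  let _ : CommGroup Q :=
    { (inferInstance : Group Q) with mul_comm := fun a b => Subtype.ext (hc a a.2 b b.2) }
  have hmem : ∀ i : ℕ, x' ^ i * (x ^ i)⁻¹ ∈ Q := by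
    intro i
    rw [← QuotientGroup.eq_one_iff] at h ⊢
    rw [QuotientGroup.mk_mul, QuotientGroup.mk_inv, mul_inv_eq_one] at h ⊢
    rw [QuotientGroup.mk_pow, QuotientGroup.mk_pow, h]
  -- `c` is a `1`-cocycle of `⟨x'⟩`; averaging it over one period shows that it is a coboundary.
  let c : ℕ → Q := fun i => ⟨x' ^ i * (x ^ i)⁻¹, hmem i⟩
  let q : Q := ⟨x' * x⁻¹, h⟩
  let φ : Q →* Q := (MulAut.conjNormal x' : MulAut Q).toMonoidHom
  have hφ : ∀ i, φ (c i) * q = c (i + 1) := by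
    intro i
    apply Subtype.ext
    simp only [φ, c, q, Subgroup.coe_mul, MulEquiv.toMonoidHom_eq_coe, MonoidHom.coe_coe,
      MulAut.conjNormal_apply]
    rw [pow_succ' x', pow_succ' x]
    group
  let u : Q := ∏ i ∈ Finset.range m, c i
  have hu : φ u * q ^ m = u := by
    have h1 : φ u * q ^ m = ∏ i ∈ Finset.range m, c (i + 1) := by
      simp only [← hφ, Finset.prod_mul_distrib, u, map_prod, Finset.prod_const, Finset.card_range]
    have h0 : c 0 = 1 := Subtype.ext (by simp [c])
    have hm : c m = 1 := Subtype.ext (by simp [c, hx, hx'])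
    have h2 := Finset.prod_range_succ c m
    rw [Finset.prod_range_succ', h0, hm, mul_one, mul_one] at h2
    rw [h1, h2]
  obtain ⟨r, -, hr⟩ := Nat.exists_mul_mod_eq_one_of_coprime hpm hp
  have hq : q ^ (m * r) = q := by
    have hqp : q ^ p = 1 := Subtype.ext (hQ _ q.2)
    rw [← Nat.div_add_mod (m * r) p, hr, pow_add, pow_mul, hqp, one_pow, one_mul, pow_one]
  have hw : φ (u ^ r) * q = u ^ r := by
    conv_rhs => rw [← hu]
    rw [mul_pow, ← map_pow, ← pow_mul, hq]
  refine ⟨(u ^ r : Q), (u ^ r).2, ?_⟩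
  have := congrArg Subtype.val hw
  simp only [φ, q, Subgroup.coe_mul, MulEquiv.toMonoidHom_eq_coe, MonoidHom.coe_coe,
      MulAut.conjNormal_apply] at this
  rw [mul_inv_eq_iff_eq_mul]
  nth_rewrite 1 [← this]
  group

/-- Splitting elements into their parts in `Q` and of order prime to `p`: every `g` is conjugate to
all its powers that are congruent to `1` modulo `m` if and only if each `y ∈ Q` can be
raised to any power prime to `p` by conjugations fixing a given `x` that commutes with `y`. -/
theorem forall_isConj_pow_iff {K : Type*} [Group K] {Q : Subgroup K}
    {p m : ℕ} (hpm : m.Coprime p)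
    (hQ : ∀ q ∈ Q, q ^ p = 1) (hm : ∀ k : K, k ^ m ∈ Q) :
    (∀ (g : K) (u : ℕ), u.Coprime p → u ≡ 1 [MOD m] → IsConj g (g ^ u)) ↔
      ∀ y ∈ Q, ∀ x : K, Commute x y → x ^ m = 1 → ∀ s : ℕ, s.Coprime p →
        ∃ k : K, k * y * k⁻¹ = y ^ s ∧ k * x * k⁻¹ = x := by
  -- `e` and `f` are the idempotents of `ℤ / (p m)`: `g ^ e` and `g ^ f` are the parts of `g`.
  obtain ⟨e, he⟩ := Nat.chineseRemainder hpm 0 1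
  obtain ⟨f, hf⟩ := Nat.chineseRemainder hpm 1 0
  have red : ∀ {n a b : ℕ} {z : K}, z ^ n = 1 → a ≡ b [MOD n] → z ^ a = z ^ b :=
    fun hz hab => pow_eq_pow_of_modEq hab hz
  constructor
  · intro H y hy x hxy hx s hs
    obtain ⟨u, hu⟩ := Nat.chineseRemainder hpm 1 s
    have hyp := hQ y hy
    have hup : u.Coprime p := by
      rw [Nat.coprime_iff_gcd_eq_one, hu.2.gcd_eq]; exact hs
    obtain ⟨k, hk⟩ := isConj_iff.1 (H (y * x) u hup hu.1)
    have key : ∀ n : ℕ, k * (y ^ n * x ^ n) * k⁻¹ = (y ^ n) ^ u * (x ^ n) ^ u := by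
      intro n
      rw [← hxy.symm.mul_pow, ← conj_pow, hk, ← (hxy.symm.pow_pow n n).mul_pow,
        ← hxy.symm.mul_pow, ← pow_mul, ← pow_mul, mul_comm]
    refine ⟨k, ?_, ?_⟩
    · have := key e
      rwa [red hyp he.2, red hx he.1, pow_one, pow_zero, one_pow, mul_one, mul_one,
        red hyp hu.2] at this
    · have := key f
      rwa [red hyp hf.2, red hx hf.1, pow_one, pow_zero, one_pow, one_mul, one_mul,
        red hx hu.1, pow_one] at this
  · intro H g u hup hu1
    have hgy : g ^ e ∈ Q := by
      obtain ⟨d, hd⟩ := (Nat.modEq_zero_iff_dvd.1 he.1)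
      rw [hd, pow_mul]; exact Q.pow_mem (hm g) d
    have hgx : (g ^ f) ^ m = 1 := by
      obtain ⟨d, hd⟩ := (Nat.modEq_zero_iff_dvd.1 hf.2)
      rw [hd, ← pow_mul, mul_comm p d, mul_assoc, mul_comm, pow_mul, mul_comm p m, pow_mul]
      rw [hQ _ (hm g), one_pow]
    have hg : g ^ e * g ^ f = g := by
      rw [← pow_add]
      have h1 : e + f ≡ 1 [MOD m * p] := by
        rw [← Nat.modEq_and_modEq_iff_modEq_mul hpm]
        exact ⟨by simpa using he.1.add hf.1, by simpa using he.2.add hf.2⟩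
      have h2 : g ^ (m * p) = 1 := by rw [pow_mul, hQ _ (hm g)]
      rw [red h2 h1, pow_one]
    have hcm : Commute (g ^ f) (g ^ e) := (Commute.refl g).pow_pow _ _
    obtain ⟨k, hk1, hk2⟩ := H _ hgy _ hcm hgx u hup
    refine isConj_iff.2 ⟨k, ?_⟩
    have : k * g * k⁻¹ = (k * g ^ e * k⁻¹) * (k * g ^ f * k⁻¹) := by
      conv_lhs => rw [← hg]
      group
    rw [this, hk1, hk2]
    conv_rhs => rw [← hg, hcm.symm.mul_pow]
    rw [red hgx hu1, pow_one]

/-- By counting, for finite `N` the existence of any isomorphism from `N/ker f` to the codomain of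
`f` forces `f` to be surjective. -/
theorem nonempty_quotient_mulEquiv_iff {N M : Type*} [Group N] [Group M] [Finite N]
    (f : N →* M) (S : Subgroup N) [S.Normal] (h : f.ker = S) :
    Nonempty ((N ⧸ S) ≃* M) ↔ Function.Surjective f := by
  subst h
  constructor
  · rintro ⟨e⟩
    have : Finite M := Finite.of_equiv _ e.toEquiv
    have hbij := (Nat.bijective_iff_injective_and_card (QuotientGroup.kerLift f)).2
      ⟨QuotientGroup.kerLift_injective f, Nat.card_congr e.toEquiv⟩
    intro a
    obtain ⟨b, rfl⟩ := hbij.2 a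
    obtain ⟨c, rfl⟩ := QuotientGroup.mk_surjective b
    exact ⟨c, rfl⟩
  · intro h
    exact ⟨QuotientGroup.quotientKerEquivOfSurjective f h⟩

theorem mem_normalizerZPowers_of_conj_eq_pow {K : Type*} [Group K] [Finite K] {y k : K} {s : ℕ}
    (hk : k * y * k⁻¹ = y ^ s) : k ∈ normalizerZPowers y := by
  refine Subgroup.mem_normalizer_iff_map_conj_eq.2 ?_
  apply Subgroup.eq_of_le_of_card_ge
  · rw [MonoidHom.map_zpowers, Subgroup.zpowers_le]
    show k * y * k⁻¹ ∈ _
    rw [hk]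
    exact Subgroup.npow_mem_zpowers y s
  · exact (Subgroup.card_map_of_injective (MulAut.conj k).injective).ge

/-- `N_K(⟨y⟩)/C_K(y) ≅ Aut ⟨y⟩` means that `y` is conjugate to all generators of `⟨y⟩`. -/
theorem nonempty_mulEquiv_mulAut_iff {K : Type*} [Group K] [Finite K] (y : K) :
    Nonempty ((normalizerZPowers y ⧸ (centralizerOf y).subgroupOf (normalizerZPowers y)) ≃*
      MulAut (Subgroup.zpowers y)) ↔
    ∀ s : ℕ, s.Coprime (orderOf y) → ∃ k : K, k * y * k⁻¹ = y ^ s := by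
  have hker : (Subgroup.normalizerMonoidHom (Subgroup.zpowers y)).ker =
      (centralizerOf y).subgroupOf (normalizerZPowers y) := by
    rw [Subgroup.normalizerMonoidHom_ker, centralizerOf_eq]; rfl
  let f : normalizerZPowers y →* MulAut (Subgroup.zpowers y) :=
    Subgroup.normalizerMonoidHom (Subgroup.zpowers y)
  have hf : ∀ n : normalizerZPowers y, ((f n ⟨y, Subgroup.mem_zpowers y⟩ : Subgroup.zpowers y) : K)
      = n * y * (n : K)⁻¹ := fun n => rfl
  rw [nonempty_quotient_mulEquiv_iff f _ hker]
  constructor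
  · intro h s hs
    let φ : MulAut (Subgroup.zpowers y) :=
      { powCoprime (G := Subgroup.zpowers y) (n := s)
          (by rw [Nat.card_zpowers]; exact hs.symm) with
        map_mul' := fun a b => Commute.mul_pow (mul_comm' a b) s }
    obtain ⟨n, hn⟩ := h φ
    refine ⟨n, ?_⟩
    rw [← hf, hn]
    rfl
  · intro h φ
    have hy : orderOf (φ ⟨y, Subgroup.mem_zpowers y⟩ : K) = orderOf y := by
      rw [Subgroup.orderOf_coe, MulEquiv.orderOf_eq, Subgroup.orderOf_mk]
    obtain ⟨s, hs⟩ := (Submonoid.mem_powers_iff _ _).1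
      (mem_powers_iff_mem_zpowers.2 (φ ⟨y, Subgroup.mem_zpowers y⟩).2)
    have hcop : s.Coprime (orderOf y) := by
      rw [← hs, orderOf_pow] at hy
      have hpos := orderOf_pos y
      rw [Nat.coprime_comm, Nat.coprime_iff_gcd_eq_one]
      have h1 := Nat.div_mul_cancel (Nat.gcd_dvd_left (orderOf y) s)
      rw [hy] at h1
      exact Nat.eq_of_mul_eq_mul_left hpos (by omega)
    obtain ⟨k, hk⟩ := h s hcop
    have hkn := mem_normalizerZPowers_of_conj_eq_pow hk
    refine ⟨⟨k, hkn⟩, ?_⟩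
    apply MulEquiv.ext
    rintro ⟨_, j, rfl⟩
    have : (⟨y ^ j, ⟨j, rfl⟩⟩ : Subgroup.zpowers y) = ⟨y, Subgroup.mem_zpowers y⟩ ^ j := rfl
    show f ⟨k, hkn⟩ ⟨y ^ j, _⟩ = φ ⟨y ^ j, _⟩
    rw [this, map_zpow, map_zpow]
    congr 1
    apply Subtype.ext
    rw [hf, ← hs]
    exact hk

/-- The action on the classes of `C_K(y)/Q`, in terms of representatives in `K`. -/
theorem actsTriviallyOnClasses_iff {K : Type*} [Group K] (Q : Subgroup K) [Q.Normal] (y : K) :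
    ActsTriviallyOnClasses Q y ↔ ∀ n ∈ normalizerZPowers y, ∀ x ∈ centralizerOf y,
      ∃ c ∈ centralizerOf y, (QuotientGroup.mk (c * x * c⁻¹) : K ⧸ Q) =
        QuotientGroup.mk (n * x * n⁻¹) := by
  constructor
  · intro H n hn x hx
    have := H ⟨QuotientGroup.mk' Q n, n, hn, rfl⟩
      (ConjClasses.mk ⟨QuotientGroup.mk' Q x, x, hx, rfl⟩)
    obtain ⟨⟨_, c, hc, rfl⟩, hcx⟩ := isConj_iff.1 (ConjClasses.mk_eq_mk_iff_isConj.1 this.symm)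
    exact ⟨c, hc, congrArg Subtype.val hcx⟩
  · rintro H ⟨_, n, hn, rfl⟩ ⟨⟨_, x, hx, rfl⟩⟩
    obtain ⟨c, hc, hcx⟩ := H n hn x hx
    refine (ConjClasses.mk_eq_mk_iff_isConj.2 (isConj_iff.2
      ⟨⟨QuotientGroup.mk' Q c, c, hc, rfl⟩, Subtype.ext hcx⟩)).symm

theorem mem_centralizerOf {K : Type*} [Group K] {x y : K} :
    x ∈ centralizerOf y ↔ Commute x y := by
  rw [centralizerOf, Subgroup.mem_centralizer_singleton_iff]; exact Iff.rfl

/-- The group-theoretic content of conditions (a) and (b): for each `y`, the elements of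
order prime to `p` in `C_K(y)` are fixed by enough of `N_K(⟨y⟩)` to induce all of `Aut ⟨y⟩`. -/
theorem forall_conj_pow_iff_forall_mulAut {K : Type*} [Group K] [Finite K] {Q : Subgroup K}
    [Q.Normal] (hc : ∀ a ∈ Q, ∀ b ∈ Q, a * b = b * a) {p m : ℕ} (hp : p.Prime)
    (hpm : m.Coprime p) (hQ : ∀ q ∈ Q, q ^ p = 1) (hm : ∀ k : K, k ^ m ∈ Q) :
    (∀ y ∈ Q, ∀ x : K, Commute x y → x ^ m = 1 → ∀ s : ℕ, s.Coprime p →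
        ∃ k : K, k * y * k⁻¹ = y ^ s ∧ k * x * k⁻¹ = x) ↔
    ∀ y ∈ Q, y ≠ 1 →
      Nonempty ((normalizerZPowers y ⧸ (centralizerOf y).subgroupOf (normalizerZPowers y)) ≃*
          MulAut (Subgroup.zpowers y)) ∧
        ActsTriviallyOnClasses Q y := by
  have hord : ∀ y ∈ Q, y ≠ 1 → orderOf y = p := fun y hy hy1 =>
    (hp.eq_one_or_self_of_dvd _ (orderOf_dvd_of_pow_eq_one (hQ y hy))).resolve_left
      (fun h => hy1 (orderOf_eq_one_iff.1 h))
  constructor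
  · intro H y hy hy1
    refine ⟨(nonempty_mulEquiv_mulAut_iff y).2 fun s hs => ?_,
      (actsTriviallyOnClasses_iff Q y).2 fun n hn x hx => ?_⟩
    · rw [hord y hy hy1] at hs
      obtain ⟨k, hk, -⟩ := H y hy 1 (Commute.one_left y) (one_pow m) s hs
      exact ⟨k, hk⟩
    · -- `x ^ f` is the part of `x` of order prime to `p`; it has the same image modulo `Q`.
      obtain ⟨f, hf1, hf0⟩ := Nat.chineseRemainder hpm 1 0
      have hcx : Commute (x ^ f) y := (mem_centralizerOf.1 hx).pow_left f
      have hxm : (x ^ f) ^ m = 1 := by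
        obtain ⟨d, hd⟩ := (Nat.modEq_zero_iff_dvd.1 hf0)
        rw [hd, ← pow_mul, mul_comm p d, mul_assoc, mul_comm, pow_mul, mul_comm p m, pow_mul]
        rw [hQ _ (hm x), one_pow]
      have hxf : (QuotientGroup.mk x : K ⧸ Q) ^ f = QuotientGroup.mk x := by
        have h1 : (QuotientGroup.mk x : K ⧸ Q) ^ m = 1 := by
          rw [← QuotientGroup.mk_pow, QuotientGroup.eq_one_iff]; exact hm x
        rw [pow_eq_pow_of_modEq hf1 h1, pow_one]
      have hny : n * y * n⁻¹ ∈ Subgroup.zpowers y :=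
        (Subgroup.mem_normalizer_iff.1 hn y).1 (Subgroup.mem_zpowers y)
      obtain ⟨s, hs⟩ := (Submonoid.mem_powers_iff _ _).1 (mem_powers_iff_mem_zpowers.2 hny)
      have hsp : s.Coprime p := by
        rw [Nat.coprime_comm, hp.coprime_iff_not_dvd]
        rintro ⟨d, rfl⟩
        rw [pow_mul, hQ y hy, one_pow, eq_comm, conj_eq_one_iff] at hs
        exact hy1 hs
      obtain ⟨k, hk1, hk2⟩ := H y hy _ hcx hxm s hsp
      refine ⟨n * k⁻¹, mem_centralizerOf.2 ?_, ?_⟩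
      · have h1 : k⁻¹ * (y ^ s) * k = y := by rw [← hk1]; group
        rw [hs] at h1
        have h2 : (n * k⁻¹) * y ^ s * (n * k⁻¹)⁻¹ = y ^ s := by
          rw [hs]
          calc n * k⁻¹ * (n * y * n⁻¹) * (n * k⁻¹)⁻¹ = n * (k⁻¹ * (n * y * n⁻¹) * k) * n⁻¹ := by
                group
            _ = _ := by rw [h1]
        -- `y` is a power of `y ^ s`
        obtain ⟨r, hr⟩ := Nat.exists_mul_mod_eq_one_of_coprime hsp hp.one_lt
        have h3 : (y ^ s) ^ r = y := by
          rw [← pow_mul, ← Nat.div_add_mod (s * r) p, hr.2, pow_add, pow_mul, hQ y hy, one_pow,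
            one_mul, pow_one]
        have h4 : Commute (n * k⁻¹) (y ^ s) := mul_inv_eq_iff_eq_mul.1 h2
        have := h4.pow_right r
        rwa [h3] at this
      · simp only [QuotientGroup.mk_mul, QuotientGroup.mk_inv]
        have h5 : (QuotientGroup.mk k : K ⧸ Q) * QuotientGroup.mk x * (QuotientGroup.mk k)⁻¹ =
            QuotientGroup.mk x := by
          have := congrArg (QuotientGroup.mk : K → K ⧸ Q) hk2
          simpa only [QuotientGroup.mk_mul, QuotientGroup.mk_inv, QuotientGroup.mk_pow, hxf]
            using this
        conv_lhs => rw [← h5]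
        group
  · intro H y hy x hxy hx s hs
    by_cases hy1 : y = 1
    · exact ⟨1, by simp [hy1], by simp⟩
    obtain ⟨ha, hb⟩ := H y hy hy1
    obtain ⟨n, hn⟩ := (nonempty_mulEquiv_mulAut_iff y).1 ha s (by rwa [hord y hy hy1])
    obtain ⟨c, hc', hcx⟩ := (actsTriviallyOnClasses_iff Q y).1 hb n
      (mem_normalizerZPowers_of_conj_eq_pow hn) x (mem_centralizerOf.2 hxy)
    -- `n c⁻¹` acts on `y` as `n` does and fixes `x` modulo `Q`; correct it by an element of `Q`.
    have hk : (c⁻¹ * n) * y * (c⁻¹ * n)⁻¹ = y ^ s := by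
      have h1 : Commute c⁻¹ (y ^ s) := ((mem_centralizerOf.1 hc').inv_left).pow_right s
      calc (c⁻¹ * n) * y * (c⁻¹ * n)⁻¹ = c⁻¹ * (n * y * n⁻¹) * c := by group
        _ = y ^ s := by rw [hn, h1.eq]; group
    have hq : x * ((c⁻¹ * n) * x * (c⁻¹ * n)⁻¹)⁻¹ ∈ Q := by
      rw [← QuotientGroup.eq_one_iff, QuotientGroup.mk_mul, QuotientGroup.mk_inv, mul_inv_eq_one]
      simp only [QuotientGroup.mk_mul, QuotientGroup.mk_inv] at hcx ⊢
      calc (x : K ⧸ Q) = (c : K ⧸ Q)⁻¹ * ((c : K ⧸ Q) * x * (c : K ⧸ Q)⁻¹) * c := by group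
        _ = (c : K ⧸ Q)⁻¹ * n * x * ((c : K ⧸ Q)⁻¹ * n)⁻¹ := by rw [hcx]; group
    obtain ⟨w, hw, hwx⟩ := exists_conj_eq_of_coprime hc hp.one_lt hpm hQ
      (by rw [conj_pow, hx]; group) hx hq
    refine ⟨w * (c⁻¹ * n), ?_, ?_⟩
    · calc w * (c⁻¹ * n) * y * (w * (c⁻¹ * n))⁻¹ = w * ((c⁻¹ * n) * y * (c⁻¹ * n)⁻¹) * w⁻¹ := by
            group
        _ = y ^ s := by rw [hk, hc w hw _ (Q.pow_mem hy s)]; group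
    · calc w * (c⁻¹ * n) * x * (w * (c⁻¹ * n))⁻¹ = w * ((c⁻¹ * n) * x * (c⁻¹ * n)⁻¹) * w⁻¹ := by
            group
        _ = x := hwx

/-! ### Weights and irreducible representations -/

namespace Representation

section Weights

universe u

variable {A : Type u} {V : Type*} [AddCommGroup V] [Module ℂ V]

/-- The weight space of a linear character `μ` in a representation `ρ`: the vectors on which the
group acts through `μ`. -/
def weightSpace [Group A] (ρ : Representation ℂ A V) (μ : A →* ℂˣ) : Submodule ℂ V where
  carrier := {v | ∀ a, ρ a v = (μ a : ℂ) • v}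
  add_mem' hv hw a := by rw [map_add, hv a, hw a, smul_add]
  zero_mem' a := by rw [map_zero, smul_zero]
  smul_mem' c v hv a := by rw [map_smul, hv a, smul_comm]

theorem mem_weightSpace [Group A] {ρ : Representation ℂ A V} {μ : A →* ℂˣ} {v : V} :
    v ∈ ρ.weightSpace μ ↔ ∀ a, ρ a v = (μ a : ℂ) • v := Iff.rfl

/-- The tensor product of `ρ` with the inverse of the linear character `μ`. -/
noncomputable def twist [Group A] (ρ : Representation ℂ A V) (μ : A →* ℂˣ) :
    Representation ℂ A V where
  toFun a := ((μ a)⁻¹ : ℂ) • ρ a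
  map_one' := by simp
  map_mul' a b := by
    rw [map_mul, map_mul, smul_mul_smul_comm, Units.val_mul, mul_inv]

variable [FiniteDimensional ℂ V]

/-- The multiplicity of a linear character as a scalar product of characters. -/
theorem card_mul_finrank_weightSpace [Group A] [Fintype A] (ρ : Representation ℂ A V)
    (μ : A →* ℂˣ) :
    (Nat.card A : ℂ) * Module.finrank ℂ (ρ.weightSpace μ) =
      ∑ a, ρ.character a * (μ a : ℂ)⁻¹ := by
  have hA : (Nat.card A : ℂ) ≠ 0 := Nat.cast_ne_zero.2 Nat.card_pos.ne'
  let _ : Invertible (Nat.card A : ℂ) := invertibleOfNonzero hA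
  have hinv : (ρ.twist μ).invariants = ρ.weightSpace μ := by
    ext v
    rw [mem_invariants, mem_weightSpace]
    refine forall_congr' fun a => ?_
    show ((μ a : ℂ))⁻¹ • ρ a v = v ↔ _
    rw [inv_smul_eq_iff₀ (Units.ne_zero _)]
  have h := (ρ.twist μ).card_inv_mul_sum_char_eq_finrank
  rw [hinv, inv_mul_eq_iff_eq_mul₀ hA] at h
  rw [← h]
  refine Finset.sum_congr rfl fun a _ => ?_
  rw [mul_comm]
  simp [character, twist]

omit [FiniteDimensional ℂ V] in
theorem sum_monoidHom_apply_eq_zero [CommGroup A] [Finite A] [Fintype (A →* ℂˣ)] {a : A}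
    (ha : a ≠ 1) : ∑ μ : A →* ℂˣ, (μ a : ℂ) = 0 := by
  have : NeZero ((Monoid.exponent A : ℕ) : ℂ) :=
    ⟨Nat.cast_ne_zero.2 Monoid.exponent_ne_zero_of_finite⟩
  obtain ⟨ν, hν⟩ := CommGroup.exists_apply_ne_one_of_hasEnoughRootsOfUnity A ℂ ha
  have h : (ν a : ℂ) * ∑ μ : A →* ℂˣ, (μ a : ℂ) = ∑ μ : A →* ℂˣ, (μ a : ℂ) := by
    rw [Finset.mul_sum]
    exact Fintype.sum_equiv (Equiv.mulLeft ν) _ _ fun μ => by simp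
  have h1 : ((ν a : ℂ) - 1) * ∑ μ : A →* ℂˣ, (μ a : ℂ) = 0 := by rw [sub_mul, h, one_mul, sub_self]
  refine (mul_eq_zero.1 h1).resolve_left fun h2 => hν ?_
  exact Units.ext (sub_eq_zero.1 h2)

/-- A character of a finite abelian group is the sum of its weights with multiplicity. -/
theorem character_eq_sum_weights [CommGroup A] [Finite A] [Fintype (A →* ℂˣ)]
    (ρ : Representation ℂ A V) (b : A) :
    ρ.character b = ∑ μ : A →* ℂˣ, (Module.finrank ℂ (ρ.weightSpace μ) : ℂ) * (μ b : ℂ) := by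
  have := Fintype.ofFinite A
  have hA : (Nat.card A : ℂ) ≠ 0 := Nat.cast_ne_zero.2 Nat.card_pos.ne'
  have : NeZero ((Monoid.exponent A : ℕ) : ℂ) :=
    ⟨Nat.cast_ne_zero.2 Monoid.exponent_ne_zero_of_finite⟩
  apply mul_left_cancel₀ hA
  rw [Finset.mul_sum]
  simp_rw [← mul_assoc, card_mul_finrank_weightSpace, Finset.sum_mul]
  rw [Finset.sum_comm, Finset.sum_eq_single b]
  · simp [← Nat.card_eq_fintype_card, CommGroup.card_monoidHom_of_hasEnoughRootsOfUnity]
  · intro a _ hab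
    have h := sum_monoidHom_apply_eq_zero (A := A) (a := a⁻¹ * b)
      (by rwa [Ne, inv_mul_eq_one])
    rw [← mul_zero (ρ.character a), ← h, Finset.mul_sum]
    exact Finset.sum_congr rfl fun μ _ => by simp [mul_assoc]
  · simp

theorem finrank_eq_sum_weights [CommGroup A] [Finite A] [Fintype (A →* ℂˣ)]
    (ρ : Representation ℂ A V) :
    Module.finrank ℂ V = ∑ μ : A →* ℂˣ, Module.finrank ℂ (ρ.weightSpace μ) := by
  have h := ρ.character_eq_sum_weights 1
  simp only [char_one, map_one, Units.val_one, mul_one] at h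
  exact_mod_cast h

open scoped IsMulCommutative in
/-- On the powers of `g`, a character is a sum of powers of roots of unity. -/
theorem exists_character_pow_eq_sum [Group A] [Finite A] (ρ : Representation ℂ A V) {L : ℕ}
    (hL : ∀ g : A, g ^ L = 1) (g : A) :
    ∃ (ι : Type u) (_ : Fintype ι) (n : ι → ℕ) (z : ι → ℂ),
      (∀ i, z i ^ L = 1) ∧ ∀ k : ℕ, ρ.character (g ^ k) = ∑ i, (n i : ℂ) * z i ^ k := by
  let σ : Representation ℂ (Subgroup.zpowers g) V := ρ.comp (Subgroup.zpowers g).subtype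
  let g' : Subgroup.zpowers g := ⟨g, Subgroup.mem_zpowers g⟩
  have : NeZero ((Monoid.exponent (Subgroup.zpowers g) : ℕ) : ℂ) :=
    ⟨Nat.cast_ne_zero.2 Monoid.exponent_ne_zero_of_finite⟩
  refine ⟨Subgroup.zpowers g →* ℂˣ, Fintype.ofFinite _, fun μ => Module.finrank ℂ (σ.weightSpace μ),
    fun μ => μ g', fun μ => ?_, fun k => ?_⟩
  · have : g' ^ L = 1 := Subtype.ext (hL g)
    rw [← Units.val_pow_eq_pow_val, ← map_pow, this, map_one, Units.val_one]
  · let _ := Fintype.ofFinite (Subgroup.zpowers g →* ℂˣ)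
    have := σ.character_eq_sum_weights (g' ^ k)
    simp only [map_pow, Units.val_pow_eq_pow_val] at this
    exact this

end Weights

section Irreducible

variable {G V : Type*} [Group G] [AddCommGroup V] [Module ℂ V] {ρ : Representation ℂ G V}

theorem isIrreducible_iff : ρ.IsIrreducible ↔ Nontrivial V ∧
    ∀ W : Submodule ℂ V, (∀ g, ∀ v ∈ W, ρ g v ∈ W) → W = ⊥ ∨ W = ⊤ := by
  constructor
  · intro h
    refine ⟨?_, fun W hW => ?_⟩
    · by_contra hV
      rw [not_nontrivial_iff_subsingleton] at hV
      exact bot_ne_top (α := Subrepresentation ρ)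
        (Subrepresentation.toSubmodule_injective (Subsingleton.elim _ _))
    · exact (eq_bot_or_eq_top (⟨W, hW⟩ : Subrepresentation ρ)).imp
        (congrArg Subrepresentation.toSubmodule) (congrArg Subrepresentation.toSubmodule)
  · rintro ⟨hV, h⟩
    refine { exists_pair_ne := ⟨⊥, ⊤, fun hbt => ?_⟩, eq_bot_or_eq_top := fun W => ?_ }
    · exact bot_ne_top (α := Submodule ℂ V) (congrArg Subrepresentation.toSubmodule hbt)
    · exact (h W.toSubmodule fun g v hv => W.apply_mem_toSubmodule g hv).imp
        (fun h => Subrepresentation.toSubmodule_injective h)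
        (fun h => Subrepresentation.toSubmodule_injective h)

theorem IsIrreducible.eq_top (hρ : ρ.IsIrreducible) {W : Submodule ℂ V}
    (hW : ∀ g, ∀ v ∈ W, ρ g v ∈ W) {v : V} (hv : v ∈ W) (hv0 : v ≠ 0) : W = ⊤ :=
  ((isIrreducible_iff.1 hρ).2 W hW).resolve_left fun h => hv0 ((Submodule.mem_bot ℂ).1 (h ▸ hv))

/-- Schur's lemma. -/
theorem IsIrreducible.exists_eq_smul_one [FiniteDimensional ℂ V] (hρ : ρ.IsIrreducible)
    {T : Module.End ℂ V} (hT : ∀ g, Commute T (ρ g)) : ∃ c : ℂ, T = c • 1 := by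
  have := (isIrreducible_iff.1 hρ).1
  obtain ⟨c, hc⟩ := Module.End.exists_eigenvalue T
  obtain ⟨v, hv⟩ := hc.exists_hasEigenvector
  have htop : T.eigenspace c = ⊤ := by
    refine hρ.eq_top (fun g w hw => ?_) hv.1 hv.2
    rw [Module.End.mem_eigenspace_iff] at hw ⊢
    rw [← Module.End.mul_apply, (hT g).eq, Module.End.mul_apply, hw, map_smul]
  refine ⟨c, LinearMap.ext fun w => ?_⟩
  exact Module.End.mem_eigenspace_iff.1 (htop ▸ Submodule.mem_top : w ∈ T.eigenspace c)

/-- A normal subgroup fixing a nonzero vector of an irreducible representation acts trivially. -/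
theorem IsIrreducible.eq_one_of_apply_eq (hρ : ρ.IsIrreducible) {N : Subgroup G} [N.Normal]
    {v : V} (hv0 : v ≠ 0) (hv : ∀ x ∈ N, ρ x v = v) {x : G} (hx : x ∈ N) : ρ x = 1 := by
  let W : Submodule ℂ V :=
    { carrier := {w | ∀ x ∈ N, ρ x w = w}
      add_mem' := fun hv hw x hx => by rw [map_add, hv x hx, hw x hx]
      zero_mem' := fun x _ => map_zero _
      smul_mem' := fun c w hw x hx => by rw [map_smul, hw x hx] }
  have hW : W = ⊤ := by
    refine hρ.eq_top (fun g w hw x hx => ?_) (v := v) hv hv0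
    have h := hw (g⁻¹ * x * g) (by simpa using Subgroup.Normal.conj_mem ‹N.Normal› x hx g⁻¹)
    calc ρ x (ρ g w) = ρ g (ρ (g⁻¹ * x * g) w) := by
          rw [← Module.End.mul_apply, ← Module.End.mul_apply, ← map_mul, ← map_mul]
          congr 2
          group
      _ = ρ g w := by rw [h]
  exact LinearMap.ext fun w => (hW ▸ Submodule.mem_top : w ∈ W) x hx

/-- A representation of a finite group is irreducible or the direct sum of two smaller
ones. -/
theorem isIrreducible_or_exists_isCompl [Finite G] [Nontrivial V]
    (ρ : Representation ℂ G V) : ρ.IsIrreducible ∨ ∃ W W' : Subrepresentation ρ,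
      IsCompl W.toSubmodule W'.toSubmodule ∧ W.toSubmodule ≠ ⊥ ∧ W.toSubmodule ≠ ⊤ := by
  by_cases h : ∀ W : Submodule ℂ V, (∀ g, ∀ v ∈ W, ρ g v ∈ W) → W = ⊥ ∨ W = ⊤
  · exact Or.inl (isIrreducible_iff.2 ⟨inferInstance, h⟩)
  · push Not at h
    obtain ⟨W, hW, hbot, htop⟩ := h
    obtain ⟨W', hW'⟩ := exists_isCompl (⟨W, hW⟩ : Subrepresentation ρ)
    refine Or.inr ⟨⟨W, hW⟩, W', ⟨disjoint_iff.2 ?_, codisjoint_iff.2 ?_⟩, hbot, htop⟩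
    · exact congrArg Subrepresentation.toSubmodule (disjoint_iff.1 hW'.1)
    · exact congrArg Subrepresentation.toSubmodule (codisjoint_iff.1 hW'.2)

end Irreducible

end Representation

/-! ### Cyclotomic fields and the rationality level -/

theorem cyclotomicSubfield_eq_adjoin {n : ℕ} (hn : n ≠ 0) {ζ : ℂ} (hζ : IsPrimitiveRoot ζ n) :
    cyclotomicSubfield n = IntermediateField.adjoin ℚ {ζ} := by
  have : NeZero n := ⟨hn⟩
  apply le_antisymm
  · refine IntermediateField.adjoin_le_iff.2 fun z hz => ?_
    obtain ⟨i, -, rfl⟩ := hζ.eq_pow_of_pow_eq_one (IsPrimitiveRoot.pow_eq_one hz)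
    exact pow_mem (IntermediateField.mem_adjoin_simple_self ℚ ζ) i
  · exact IntermediateField.adjoin.mono _ _ _ (Set.singleton_subset_iff.2 hζ)

theorem mem_cyclotomicSubfield_of_pow_eq_one {n : ℕ} (hn : n ≠ 0) {z : ℂ} (hz : z ^ n = 1) :
    z ∈ cyclotomicSubfield n := by
  have : NeZero n := ⟨hn⟩
  have hζ := Complex.isPrimitiveRoot_exp n hn
  obtain ⟨i, -, rfl⟩ := hζ.eq_pow_of_pow_eq_one hz
  exact pow_mem (IntermediateField.subset_adjoin ℚ {ζ : ℂ | IsPrimitiveRoot ζ n} hζ) i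

theorem cyclotomicSubfield_le_iff {n : ℕ} (hn : n ≠ 0) {F : IntermediateField ℚ ℂ} :
    cyclotomicSubfield n ≤ F ↔ ∀ z : ℂ, z ^ n = 1 → z ∈ F :=
  ⟨fun h _ hz => h (mem_cyclotomicSubfield_of_pow_eq_one hn hz),
    fun h => IntermediateField.adjoin_le_iff.2 fun z hz => h z (IsPrimitiveRoot.pow_eq_one hz)⟩

theorem cyclotomicSubfield_mono {m n : ℕ} (hn : n ≠ 0) (h : m ∣ n) :
    cyclotomicSubfield m ≤ cyclotomicSubfield n := by
  obtain ⟨k, rfl⟩ := h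
  refine (cyclotomicSubfield_le_iff (left_ne_zero_of_mul hn)).2 fun z hz => ?_
  exact mem_cyclotomicSubfield_of_pow_eq_one hn (by rw [pow_mul, hz, one_pow])

instance cyclotomicSubfield_isCyclotomicExtension (n : ℕ) [NeZero n] :
    IsCyclotomicExtension {n} ℚ (cyclotomicSubfield n) := by
  have hζ := Complex.isPrimitiveRoot_exp n (NeZero.ne n)
  rw [cyclotomicSubfield_eq_adjoin (NeZero.ne n) hζ]
  have halg : IsAlgebraic ℚ (Complex.exp (2 * Real.pi * Complex.I / n)) :=
    ((hζ.isIntegral (NeZero.pos n)).tower_top (A := ℚ)).isAlgebraic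
  change IsCyclotomicExtension {n} ℚ (IntermediateField.adjoin ℚ
    {Complex.exp (2 * Real.pi * Complex.I / n)}).toSubalgebra
  rw [IntermediateField.adjoin_simple_toSubalgebra_of_isAlgebraic halg]
  exact hζ.adjoin_isCyclotomicExtension ℚ

instance cyclotomicSubfield_numberField (n : ℕ) [NeZero n] :
    NumberField (cyclotomicSubfield n) :=
  IsCyclotomicExtension.numberField {n} ℚ _

instance cyclotomicSubfield_isGalois (n : ℕ) [NeZero n] :
    IsGalois ℚ (cyclotomicSubfield n) :=
  IsCyclotomicExtension.isGalois {n} ℚ _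

/-- `τ` is the automorphism of `ℚ_L` that raises the `L`-th roots of unity to the power `u`. -/
def IsPowerAut {L : ℕ} (τ : Gal(cyclotomicSubfield L/ℚ)) (u : ℕ) : Prop :=
  ∀ z : cyclotomicSubfield L, z ^ L = 1 → τ z = z ^ u

theorem exists_isPowerAut {L : ℕ} [NeZero L] {u : ℕ} (hu : u.Coprime L) :
    ∃ τ : Gal(cyclotomicSubfield L/ℚ), IsPowerAut τ u := by
  refine ⟨(IsCyclotomicExtension.Rat.galEquivZMod L (cyclotomicSubfield L)).symm
    (ZMod.unitOfCoprime u hu), fun z hz => ?_⟩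
  rw [IsCyclotomicExtension.Rat.galEquivZMod_apply_of_pow_eq L _ _ hz, MulEquiv.apply_symm_apply,
    ZMod.coe_unitOfCoprime, ZMod.val_natCast]
  exact pow_eq_pow_of_modEq (Nat.mod_modEq u L) hz

theorem exists_coprime_isPowerAut {L : ℕ} [NeZero L] (τ : Gal(cyclotomicSubfield L/ℚ)) :
    ∃ u : ℕ, u.Coprime L ∧ IsPowerAut τ u :=
  ⟨_, ZMod.val_coe_unit_coprime _, fun _ hz =>
    IsCyclotomicExtension.Rat.galEquivZMod_apply_of_pow_eq L _ τ hz⟩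

/-- Automorphisms of `ℚ_L` raising roots of unity to powers congruent modulo `d` agree
on `ℚ_d`. -/
theorem IsPowerAut.eq_of_mem {L d : ℕ} (hd : d ≠ 0) (hL : L ≠ 0) (hdL : d ∣ L)
    {τ τ' : Gal(cyclotomicSubfield L/ℚ)} {u u' : ℕ} (hτ : IsPowerAut τ u) (hτ' : IsPowerAut τ' u')
    (h : u ≡ u' [MOD d]) {x : cyclotomicSubfield L} (hx : (x : ℂ) ∈ cyclotomicSubfield d) :
    τ x = τ' x := by
  let S : IntermediateField ℚ (cyclotomicSubfield L) :=
    IntermediateField.fixedField (Subgroup.zpowers (τ'⁻¹ * τ))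
  have hS : ∀ y : cyclotomicSubfield L, y ∈ S ↔ τ y = τ' y := by
    intro y
    rw [IntermediateField.mem_fixedField_iff]
    constructor
    · intro H
      have := H _ (Subgroup.mem_zpowers _)
      rw [AlgEquiv.mul_apply] at this
      conv_rhs => rw [← this]
      rw [← AlgEquiv.mul_apply, mul_inv_cancel, AlgEquiv.one_apply]
    · intro H f hf
      have h1 : (τ'⁻¹ * τ) ∈ MulAction.stabilizer Gal(cyclotomicSubfield L/ℚ) y := by
        rw [MulAction.mem_stabilizer_iff, AlgEquiv.smul_def, AlgEquiv.mul_apply, H,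
          ← AlgEquiv.mul_apply, inv_mul_cancel, AlgEquiv.one_apply]
      exact (Subgroup.zpowers_le.2 h1) hf
  have hle : cyclotomicSubfield d ≤ IntermediateField.lift S := by
    refine (cyclotomicSubfield_le_iff hd).2 fun z hz => ?_
    have hzL : z ∈ cyclotomicSubfield L :=
      cyclotomicSubfield_mono hL hdL (mem_cyclotomicSubfield_of_pow_eq_one hd hz)
    have hz' : (⟨z, hzL⟩ : cyclotomicSubfield L) ^ d = 1 := Subtype.ext hz
    refine (IntermediateField.mem_lift (⟨z, hzL⟩ : cyclotomicSubfield L)).2 ((hS _).2 ?_)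
    have hz'' : (⟨z, hzL⟩ : cyclotomicSubfield L) ^ L = 1 := by
      apply Subtype.ext
      obtain ⟨k, hk⟩ := hdL
      show z ^ L = 1
      rw [hk, pow_mul, hz, one_pow]
    rw [hτ _ hz'', hτ' _ hz'']
    exact pow_eq_pow_of_modEq h hz'
  exact (hS x).1 ((IntermediateField.mem_lift x).1 (hle hx))

/-- The Galois-theoretic description of `ℚ_d` inside `ℚ_L`. -/
theorem mem_cyclotomicSubfield_iff {L d : ℕ} [NeZero L] (hdL : d ∣ L)
    (x : cyclotomicSubfield L) : (x : ℂ) ∈ cyclotomicSubfield d ↔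
      ∀ (τ : Gal(cyclotomicSubfield L/ℚ)) (u : ℕ), u.Coprime L → u ≡ 1 [MOD d] →
        IsPowerAut τ u → τ x = x := by
  have hd : d ≠ 0 := fun h => NeZero.ne L (Nat.eq_zero_of_zero_dvd (h ▸ hdL))
  constructor
  · intro hx τ u _ hu1 hτ
    exact hτ.eq_of_mem hd (NeZero.ne L) hdL (τ' := 1) (u' := 1) (fun z _ => (pow_one z).symm)
      hu1 hx
  · intro H
    let F : IntermediateField ℚ (cyclotomicSubfield L) :=
      (cyclotomicSubfield d).comap (cyclotomicSubfield L).val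
    suffices x ∈ F from this
    rw [← IsGalois.fixedField_fixingSubgroup F, IntermediateField.mem_fixedField_iff]
    intro τ hτ
    obtain ⟨u, huL, hu⟩ := exists_coprime_isPowerAut τ
    refine H τ u huL ?_ hu
    have hζ := Complex.isPrimitiveRoot_exp d hd
    set ζ := Complex.exp (2 * Real.pi * Complex.I / d)
    have hζd : ζ ∈ cyclotomicSubfield d := mem_cyclotomicSubfield_of_pow_eq_one hd hζ.pow_eq_one
    have hζL := cyclotomicSubfield_mono (NeZero.ne L) hdL hζd
    have h1 : τ ⟨ζ, hζL⟩ = ⟨ζ, hζL⟩ :=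
      (IntermediateField.mem_fixingSubgroup_iff _ _).1 hτ _ hζd
    rw [hu] at h1
    · have h2 : ζ ^ u = ζ ^ 1 := by rw [pow_one]; exact congrArg Subtype.val h1
      rw [hζ.eq_orderOf]
      exact (hζ.isOfFinOrder hd).pow_eq_pow_iff_modEq.1 h2
    · obtain ⟨k, hk⟩ := hdL
      apply Subtype.ext
      show ζ ^ L = 1
      rw [hk, pow_mul, hζ.pow_eq_one, one_pow]

theorem cyclotomicSubfield_inf_le {a b : ℕ} (ha : a ≠ 0) (hb : b ≠ 0) :
    cyclotomicSubfield a ⊓ cyclotomicSubfield b ≤ cyclotomicSubfield (a.gcd b) := by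
  rintro x ⟨hxa, hxb⟩
  have : NeZero (a * b) := ⟨mul_ne_zero ha hb⟩
  have hxL : x ∈ cyclotomicSubfield (a * b) :=
    cyclotomicSubfield_mono (NeZero.ne _) (dvd_mul_right a b) hxa
  refine (mem_cyclotomicSubfield_iff ((Nat.gcd_dvd_left a b).trans (dvd_mul_right a b))
    ⟨x, hxL⟩).2 fun τ u huL hu hτ => ?_
  -- `τ` agrees on `ℚ_b` with an automorphism that is trivial on `ℚ_a`.
  obtain ⟨v, hv1, hvu⟩ := Nat.chineseRemainder' hu.symm
  have hvL : v.Coprime (a * b) := by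
    refine Nat.Coprime.mul_right ?_ ?_
    · rw [Nat.coprime_iff_gcd_eq_one, hv1.gcd_eq]; simp
    · rw [Nat.coprime_iff_gcd_eq_one, hvu.gcd_eq]; exact Nat.Coprime.coprime_mul_left_right huL
  obtain ⟨σ, hσ⟩ := exists_isPowerAut hvL
  rw [hτ.eq_of_mem hb (NeZero.ne _) (dvd_mul_left b a) hσ hvu.symm hxb]
  exact hσ.eq_of_mem ha (NeZero.ne _) (dvd_mul_right a b) (τ' := 1) (u' := 1)
    (fun z _ => (pow_one z).symm) hv1 hxa

theorem le_cyclotomicSubfield_iff_conductor_dvd {F : IntermediateField ℚ ℂ} {n k : ℕ} (hn : n ≠ 0)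
    (hF : F ≤ cyclotomicSubfield n) (hk : k ≠ 0) :
    F ≤ cyclotomicSubfield k ↔ fieldConductor F ∣ k := by
  have hmem : 0 < fieldConductor F ∧ F ≤ cyclotomicSubfield (fieldConductor F) :=
    Nat.sInf_mem (s := {n : ℕ | 0 < n ∧ F ≤ cyclotomicSubfield n}) ⟨n, hn.bot_lt, hF⟩
  constructor
  · intro h
    have hg : fieldConductor F ≤ (fieldConductor F).gcd k :=
      Nat.sInf_le ⟨Nat.gcd_pos_of_pos_left _ hmem.1,
        (le_inf hmem.2 h).trans (cyclotomicSubfield_inf_le hmem.1.ne' hk)⟩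
    have := Nat.le_antisymm hg (Nat.gcd_le_left _ hmem.1)
    rw [this]
    exact Nat.gcd_dvd_right _ _
  · exact fun h => hmem.2.trans (cyclotomicSubfield_mono hk h)

/-- A character with values in `ℚ_{p^a m}`, `p ∤ m`, has `p`-rationality level `1` exactly when
its values lie in `ℚ_{pm}` but not in `ℚ_m`. -/
theorem pRationalityLevel_eq_one_iff {p : ℕ} [hp : Fact p.Prime] {G : Type*} {χ : G → ℂ} {a m : ℕ}
    (hm : m.Coprime p) (hm0 : m ≠ 0) (hχ : fieldOfValues χ ≤ cyclotomicSubfield (p ^ a * m)) :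
    pRationalityLevel p χ = 1 ↔ fieldOfValues χ ≤ cyclotomicSubfield (p * m) ∧
      ¬ fieldOfValues χ ≤ cyclotomicSubfield m := by
  have hp0 := hp.out.ne_zero
  have hn : p ^ a * m ≠ 0 := mul_ne_zero (pow_ne_zero _ hp0) hm0
  rw [le_cyclotomicSubfield_iff_conductor_dvd hn hχ hm0,
    le_cyclotomicSubfield_iff_conductor_dvd hn hχ (mul_ne_zero hp0 hm0)]
  have hc := (le_cyclotomicSubfield_iff_conductor_dvd hn hχ hn).1 hχ
  rw [pRationalityLevel, charConductor]
  set c := fieldConductor (fieldOfValues χ)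
  have hc0 : c ≠ 0 := fun h => hn (Nat.eq_zero_of_zero_dvd (h ▸ hc))
  constructor
  · intro h
    have h1 : p ∣ c := dvd_of_one_le_padicValNat h.ge
    refine ⟨?_, fun h2 => ?_⟩
    · obtain ⟨d, hd⟩ := h1
      rw [hd] at hc hc0 h ⊢
      have hd0 := right_ne_zero_of_mul hc0
      rw [padicValNat.mul hp0 hd0, padicValNat_self] at h
      have hpd : ¬ p ∣ d := fun hpd => by
        have := one_le_padicValNat_of_dvd hd0 hpd
        omega
      have hcop : d.Coprime (p ^ a) := ((hp.out.coprime_iff_not_dvd.2 hpd).pow_left a).symm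
      exact mul_dvd_mul_left p (hcop.dvd_of_dvd_mul_left ((dvd_mul_left d p).trans hc))
    · exact (hp.out.coprime_iff_not_dvd.1 hm.symm) (h1.trans h2)
  · rintro ⟨h1, h2⟩
    have hpc : p ∣ c := by
      by_contra hpc
      exact h2 (((hp.out.coprime_iff_not_dvd.2 hpc).symm).dvd_of_dvd_mul_left h1)
    obtain ⟨d, hd⟩ := hpc
    rw [hd] at h1 hc0 ⊢
    have hd0 := right_ne_zero_of_mul hc0
    have hdm := Nat.dvd_of_mul_dvd_mul_left hp.out.pos h1
    rw [padicValNat.mul hp0 hd0, padicValNat_self, padicValNat.eq_zero_of_not_dvd]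
    exact fun h => (hp.out.coprime_iff_not_dvd.1 hm.symm) (h.trans hdm)

/-- Galois automorphisms act on the values of a character through the power maps of the group. The
hypothesis on `χ` says that on the powers of `g` it is a sum of powers of `L`-th roots of
unity. -/
theorem fieldOfValues_le_cyclotomicSubfield_iff.{u} {G : Type u} [Group G] {χ : G → ℂ} {L d : ℕ}
    (hL : L ≠ 0) (hdL : d ∣ L)
    (hχ : ∀ g : G, ∃ (ι : Type u) (_ : Fintype ι) (n : ι → ℕ) (z : ι → ℂ),
      (∀ i, z i ^ L = 1) ∧ ∀ k : ℕ, χ (g ^ k) = ∑ i, (n i : ℂ) * z i ^ k) :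
    fieldOfValues χ ≤ cyclotomicSubfield d ↔
      ∀ u : ℕ, u.Coprime L → u ≡ 1 [MOD d] → ∀ g, χ (g ^ u) = χ g := by
  have : NeZero L := ⟨hL⟩
  have hmem : ∀ g, χ g ∈ cyclotomicSubfield L := by
    intro g
    obtain ⟨ι, _, n, z, hz, h⟩ := hχ g
    have := h 1
    rw [pow_one] at this
    rw [this]
    refine sum_mem fun i _ => mul_mem (natCast_mem _ _) (pow_mem ?_ _)
    exact mem_cyclotomicSubfield_of_pow_eq_one hL (hz i)
  have hgal : ∀ (τ : Gal(cyclotomicSubfield L/ℚ)) (u : ℕ), IsPowerAut τ u → ∀ g,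
      (τ ⟨χ g, hmem g⟩ : ℂ) = χ (g ^ u) := by
    intro τ u hτ g
    obtain ⟨ι, _, n, z, hz, h⟩ := hχ g
    let z' : ι → cyclotomicSubfield L :=
      fun i => ⟨z i, mem_cyclotomicSubfield_of_pow_eq_one hL (hz i)⟩
    have h1 : (⟨χ g, hmem g⟩ : cyclotomicSubfield L) =
        ∑ i, (n i : cyclotomicSubfield L) * z' i := by
      apply Subtype.ext
      have := h 1
      simp only [pow_one] at this
      simp [this, z']
    have h2 : ∀ i, τ (z' i) = z' i ^ u := fun i => hτ _ (Subtype.ext (hz i))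
    rw [h1, map_sum, h u]
    simp [h2, z']
  rw [fieldOfValues, IntermediateField.adjoin_le_iff, Set.range_subset_iff]
  constructor
  · intro H u huL hud g
    obtain ⟨τ, hτ⟩ := exists_isPowerAut huL
    rw [← hgal τ u hτ g]
    exact congrArg Subtype.val
      ((mem_cyclotomicSubfield_iff hdL ⟨χ g, hmem g⟩).1 (H g) τ u huL hud hτ)
  · intro H g
    refine (mem_cyclotomicSubfield_iff hdL ⟨χ g, hmem g⟩).2 fun τ u huL hud hτ => Subtype.ext ?_
    rw [hgal τ u hτ g, H u huL hud g]

/-! ### Degrees and separation of conjugacy classes -/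

namespace Representation

section Degree

variable {G V : Type*} [Group G] [Finite G] [AddCommGroup V] [Module ℂ V] [FiniteDimensional ℂ V]

theorem isIntegral_character (ρ : Representation ℂ G V) (g : G) :
    IsIntegral ℤ (ρ.character g) := by
  obtain ⟨ι, _, n, z, hz, h⟩ := ρ.exists_character_pow_eq_sum (L := Nat.card G)
    (fun g => pow_card_eq_one') g
  have h1 := h 1
  simp only [pow_one] at h1
  rw [h1]
  refine IsIntegral.sum _ fun i _ => (isIntegral_algebraMap (x := (n i : ℤ))).mul ?_ |> fun h => by
    simpa using h
  exact IsIntegral.of_pow Nat.card_pos (by rw [hz]; exact isIntegral_one)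

/-- The sum of the conjugates of `g` acts as a scalar, which is an algebraic integer. -/
theorem IsIrreducible.exists_sum_conj_eq_smul_one [Fintype G] {ρ : Representation ℂ G V}
    (hρ : ρ.IsIrreducible) (g : G) : ∃ c : ℂ, IsIntegral ℤ c ∧
      ∑ h : G, ρ (h * g * h⁻¹) = c • 1 ∧
      (Nat.card G : ℂ) * ρ.character g = c * Module.finrank ℂ V := by
  have := (isIrreducible_iff.1 hρ).1
  obtain ⟨c, hc⟩ := hρ.exists_eq_smul_one (T := ∑ h : G, ρ (h * g * h⁻¹)) (by
    intro k
    show _ * _ = _ * _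
    rw [Finset.sum_mul, Finset.mul_sum]
    refine Fintype.sum_equiv (Equiv.mulLeft k⁻¹) _ _ fun h => ?_
    rw [← map_mul, ← map_mul]
    congr 1
    simp only [Equiv.coe_mulLeft]
    group)
  refine ⟨c, ?_, hc, ?_⟩
  · let φ : MonoidAlgebra ℤ G →ₐ[ℤ] Module.End ℂ V := MonoidAlgebra.lift ℤ _ G ρ
    have hφ : φ (∑ h : G, MonoidAlgebra.of ℤ G (h * g * h⁻¹)) = ∑ h : G, ρ (h * g * h⁻¹) := by
      rw [map_sum]
      exact Finset.sum_congr rfl fun h _ => MonoidAlgebra.lift_of _ _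
    have hint : IsIntegral ℤ (algebraMap ℂ (Module.End ℂ V) c) := by
      rw [Algebra.algebraMap_eq_smul_one, ← hc, ← hφ]
      exact (IsIntegral.of_finite ℤ _).map φ
    exact (isIntegral_algebraMap_iff (FaithfulSMul.algebraMap_injective ℂ _)).1 hint
  · have h := congrArg (LinearMap.trace ℂ V) hc
    rw [map_sum, map_smul, LinearMap.trace_one, smul_eq_mul] at h
    have hk : ∀ k : G, LinearMap.trace ℂ V (ρ (k * g * k⁻¹)) = ρ.character g :=
      fun k => ρ.char_conj g k
    rw [← h, Finset.sum_congr rfl fun k _ => hk k, Finset.sum_const, Finset.card_univ,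
      nsmul_eq_mul, Nat.card_eq_fintype_card]

/-- The degree of an irreducible representation divides the square of the order of the group. (It
divides the order, but only the prime divisors matter below.) -/
theorem IsIrreducible.finrank_dvd_card_sq {ρ : Representation ℂ G V}
    (hρ : ρ.IsIrreducible) : Module.finrank ℂ V ∣ Nat.card G ^ 2 := by
  have := Fintype.ofFinite G
  have := (isIrreducible_iff.1 hρ).1
  have hG : (Nat.card G : ℂ) ≠ 0 := Nat.cast_ne_zero.2 Nat.card_pos.ne'
  have hd : (Module.finrank ℂ V : ℚ) ≠ 0 := Nat.cast_ne_zero.2 Module.finrank_pos.ne'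
  let _ : Invertible (Nat.card G : ℂ) := invertibleOfNonzero hG
  choose c hcint _ hc using hρ.exists_sum_conj_eq_smul_one
  have horth : ∑ g, ρ.character g * ρ.character g⁻¹ = Nat.card G := by
    have := ρ.char_orthonormal ρ
    rwa [if_pos ⟨Representation.Equiv.refl ρ⟩, inv_mul_eq_iff_eq_mul₀ hG, mul_one] at this
  have hs : (Module.finrank ℂ V : ℂ) * ∑ g, c g * ρ.character g⁻¹ = (Nat.card G : ℂ) ^ 2 := by
    rw [sq]
    nth_rewrite 2 [← horth]
    rw [Finset.mul_sum, Finset.mul_sum]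
    refine Finset.sum_congr rfl fun g _ => ?_
    rw [← mul_assoc, ← mul_assoc, hc, mul_comm (c g)]
  have hsint : IsIntegral ℤ (∑ g, c g * ρ.character g⁻¹) :=
    IsIntegral.sum _ fun g _ => (hcint g).mul (ρ.isIntegral_character g⁻¹)
  have hrat : ∑ g, c g * ρ.character g⁻¹ =
      algebraMap ℚ ℂ ((Nat.card G : ℚ) ^ 2 / Module.finrank ℂ V) := by
    have hd' : (Module.finrank ℂ V : ℂ) ≠ 0 := by exact_mod_cast hd
    rw [map_div₀, eq_div_iff (by simpa using hd'), mul_comm]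
    simpa using hs
  rw [hrat, isIntegral_algebraMap_iff (algebraMap ℚ ℂ).injective,
    IsIntegrallyClosed.isIntegral_iff] at hsint
  obtain ⟨y, hy⟩ := hsint
  rw [eq_div_iff hd, eq_intCast] at hy
  have : y * (Module.finrank ℂ V : ℤ) = (Nat.card G : ℤ) ^ 2 := by exact_mod_cast hy
  exact_mod_cast Dvd.intro_left y this

/-- A representation of a `p`-group of degree prime to `p` contains a linear character. -/
theorem exists_eigenvector_of_isPGroup {p : ℕ} [hp : Fact p.Prime] (hG : IsPGroup p G)
    (ρ : Representation ℂ G V) (hV : ¬ p ∣ Module.finrank ℂ V) :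
    ∃ v : V, v ≠ 0 ∧ ∀ g, ∃ c : ℂ, ρ g v = c • v := by
  induction hn : Module.finrank ℂ V using Nat.strong_induction_on generalizing V with
  | _ n ih =>
  have hV0 : Module.finrank ℂ V ≠ 0 := fun h => hV (h ▸ dvd_zero p)
  have : Nontrivial V := Module.nontrivial_of_finrank_pos hV0.bot_lt
  rcases ρ.isIrreducible_or_exists_isCompl with hρ | ⟨W, W', hW, hbot, htop⟩
  · obtain ⟨k, hk⟩ := IsPGroup.iff_card.1 hG
    have hdvd := hρ.finrank_dvd_card_sq
    rw [hk, ← pow_mul] at hdvd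
    have h1 : Module.finrank ℂ V = 1 :=
      (((hp.out.coprime_iff_not_dvd.2 hV).pow_left (k * 2)).symm).eq_one_of_dvd hdvd
    obtain ⟨v, hv⟩ := exists_ne (0 : V)
    exact ⟨v, hv, fun g => (exists_smul_eq_of_finrank_eq_one h1 hv (ρ g v)).imp fun _ h => h.symm⟩
  · have hsum := Submodule.finrank_add_eq_of_isCompl hW
    have h1 := Submodule.finrank_lt (lt_top_iff_ne_top.2 htop).ne
    have h2 : 0 < Module.finrank ℂ W.toSubmodule :=
      Nat.pos_of_ne_zero fun h => hbot (Submodule.finrank_eq_zero.1 h)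
    have key : ∀ U : Subrepresentation ρ, Module.finrank ℂ U.toSubmodule < n →
        ¬ p ∣ Module.finrank ℂ U.toSubmodule → ∃ v : V, v ≠ 0 ∧ ∀ g, ∃ c : ℂ, ρ g v = c • v := by
      intro U hU hpU
      obtain ⟨v, hv, h⟩ := ih _ hU U.toRepresentation hpU rfl
      exact ⟨v, fun h0 => hv (Subtype.ext h0),
        fun g => (h g).imp fun c hc => congrArg Subtype.val hc⟩
    by_cases hp1 : p ∣ Module.finrank ℂ W.toSubmodule
    · refine key W' (by omega) fun hp2 => hV ?_
      rw [← hsum]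
      exact dvd_add hp1 hp2
    · exact key W (by omega) hp1

end Degree

section Separation

variable {G : Type*} [Group G]

theorem isIrrChar_character {V : Type*} [AddCommGroup V] [Module ℂ V] [FiniteDimensional ℂ V]
    {ρ : Representation ℂ G V} (hρ : ρ.IsIrreducible) : IsIrrChar ρ.character := by
  let e : V ≃ₗ[ℂ] (Fin (Module.finrank ℂ V) → ℂ) := (Module.finBasis ℂ V).equivFun
  let σ : Representation ℂ G (Fin (Module.finrank ℂ V) → ℂ) :=
    (e.conjRingEquiv : Module.End ℂ V →* _).comp ρ
  have hσ : ∀ g v, σ g (e v) = e (ρ g v) := fun g v => by simp [σ]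
  refine ⟨_, σ, isIrreducible_iff.2 ⟨?_, fun W hW => ?_⟩, funext fun g => ?_⟩
  · have := (isIrreducible_iff.1 hρ).1
    exact e.symm.toEquiv.nontrivial
  · have h := (isIrreducible_iff.1 hρ).2 (W.comap e.toLinearMap) fun g v hv => by
      have := hW g _ hv
      rwa [Submodule.mem_comap, LinearEquiv.coe_coe, ← hσ]
    refine h.imp (fun h => ?_) (fun h => ?_)
    · rw [← Submodule.map_comap_eq_of_surjective e.surjective W]
      erw [h]; simp
    · rw [← Submodule.map_comap_eq_of_surjective e.surjective W]
      erw [h]; simp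
  · exact LinearMap.trace_conj' (ρ g) e

/-- The irreducible characters separate the conjugacy classes. -/
theorem isConj_of_forall_isIrrChar [Finite G] {g g' : G}
    (h : ∀ χ : G → ℂ, IsIrrChar χ → χ g = χ g') : IsConj g g' := by
  have := Fintype.ofFinite G
  -- The sums of the conjugates of `g` and of `g'` act equally on every representation.
  have key : ∀ (n : ℕ) (V : Type _) [AddCommGroup V] [Module ℂ V] [FiniteDimensional ℂ V]
      (ρ : Representation ℂ G V), Module.finrank ℂ V = n →
      ∑ k : G, ρ (k * g * k⁻¹) = ∑ k : G, ρ (k * g' * k⁻¹) := by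
    intro n
    induction n using Nat.strong_induction_on with
    | _ n ih =>
    intro V _ _ _ ρ hn
    rcases subsingleton_or_nontrivial V with hV | hV
    · exact Subsingleton.elim _ _
    rcases ρ.isIrreducible_or_exists_isCompl with hρ | ⟨W, W', hW, hbot, htop⟩
    · obtain ⟨c, -, hc, hcg⟩ := hρ.exists_sum_conj_eq_smul_one g
      obtain ⟨c', -, hc', hcg'⟩ := hρ.exists_sum_conj_eq_smul_one g'
      rw [h _ (isIrrChar_character hρ), hcg'] at hcg
      rw [hc, hc', mul_right_cancel₀ (Nat.cast_ne_zero.2 Module.finrank_pos.ne') hcg]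
    · have hsum := Submodule.finrank_add_eq_of_isCompl hW
      have h1 := Submodule.finrank_lt (lt_top_iff_ne_top.2 htop).ne
      have h2 : 0 < Module.finrank ℂ W.toSubmodule :=
        Nat.pos_of_ne_zero fun h => hbot (Submodule.finrank_eq_zero.1 h)
      have hU : ∀ U : Subrepresentation ρ, Module.finrank ℂ U.toSubmodule < n →
          ∀ v ∈ U.toSubmodule, (∑ k : G, ρ (k * g * k⁻¹)) v = (∑ k : G, ρ (k * g' * k⁻¹)) v := by
        intro U hUn v hv
        have := congrArg (fun T => ((T ⟨v, hv⟩ : U.toSubmodule) : V))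
          (ih _ hUn U.toSubmodule U.toRepresentation rfl)
        simpa [LinearMap.sum_apply, Subrepresentation.toRepresentation] using this
      refine LinearMap.ext fun v => ?_
      obtain ⟨w, hw, w', hw', rfl⟩ := Submodule.mem_sup.1
        (hW.sup_eq_top ▸ Submodule.mem_top : v ∈ W.toSubmodule ⊔ W'.toSubmodule)
      rw [map_add, map_add, hU W (by omega) w hw, hU W' (by omega) w' hw']
  -- In the regular representation this is an identity in the group algebra.
  have hreg := key _ _ (leftRegular ℂ G) rfl
  by_contra hgg
  have h1 := congrArg (fun T : Module.End ℂ (MonoidAlgebra ℂ G) =>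
    (MonoidAlgebra.coeffLinearEquiv ℂ (T (MonoidAlgebra.single 1 1))) g) hreg
  simp only [LinearMap.sum_apply, map_sum, Finsupp.finsetSum_apply,
    ofMulAction_single, smul_eq_mul, mul_one] at h1
  have hg' : ∀ k : G, k * g' * k⁻¹ ≠ g := fun k hk => hgg (isConj_iff.2 ⟨k, hk⟩).symm
  classical
  have hpos : ∑ k : G, (if k * g * k⁻¹ = g then (1 : ℂ) else 0) = 0 := by
    simpa [MonoidAlgebra.coeff_single, Finsupp.single_apply, hg'] using h1
  rw [Finset.sum_boole, Nat.cast_eq_zero, Finset.card_eq_zero, Finset.filter_eq_empty_iff] at hpos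
  exact hpos (Finset.mem_univ 1) (by simp)

end Separation

end Representation

/-! ### Characters trivial on the Frattini subgroup -/

theorem isCoatom_of_prime_index {G : Type*} [Group G] {H : Subgroup G} (hH : H.index.Prime) :
    IsCoatom H := by
  refine ⟨fun h => hH.ne_one (Subgroup.index_eq_one.2 h), fun K hK => ?_⟩
  have h := Subgroup.relIndex_mul_index hK.le
  rcases (Nat.dvd_prime hH).1 (Dvd.intro_left _ h) with h1 | h1
  · exact Subgroup.index_eq_one.1 h1
  · rw [h1] at h
    have h2 := Nat.eq_of_mul_eq_mul_right hH.pos (h.trans (one_mul _).symm)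
    exact absurd (Subgroup.relIndex_eq_one.1 h2) (not_le_of_gt hK)

/-- The kernel of a linear character with values in the `p`-th roots of unity has index `1` or
`p`, so it contains the Frattini subgroup. -/
theorem frattini_le_ker_of_forall_pow_eq_one {P : Type*} [Group P] [Finite P] {p : ℕ}
    [hp : Fact p.Prime] (f : P →* ℂˣ) (hf : ∀ x, f x ^ p = 1) : frattini P ≤ f.ker := by
  have : NeZero p := ⟨hp.out.ne_zero⟩
  have hle : f.range ≤ rootsOfUnity p ℂ := by
    rintro _ ⟨x, rfl⟩
    exact hf x
  have hdvd : f.ker.index ∣ p := by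
    rw [Subgroup.index_ker]
    have := Subgroup.card_dvd_of_le hle
    rwa [HasEnoughRootsOfUnity.natCard_rootsOfUnity] at this
  rcases (Nat.dvd_prime hp.out).1 hdvd with h | h
  · rw [Subgroup.index_eq_one.1 h]; exact le_top
  · exact frattini_le_coatom (isCoatom_of_prime_index (h ▸ hp.out))

/-- On a finite abelian `p`-group, a multiplicity function invariant under the
`(1 + p)`-power map and with sum prime to `p` is nonzero at some `μ` with `μ ^ p = 1`. -/
theorem exists_pow_prime_eq_one_of_sum {M : Type*} [CommGroup M] [Fintype M] {p : ℕ}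
    [hp : Fact p.Prime] (hM : IsPGroup p M) (n : M → ℕ) (hn : ∀ μ, n (μ ^ (1 + p)) = n μ)
    (hsum : ¬ p ∣ ∑ μ, n μ) : ∃ μ, μ ^ p = 1 ∧ n μ ≠ 0 := by
  obtain ⟨k, hk⟩ := IsPGroup.iff_card.1 hM
  have hcop : (Nat.card M).Coprime (1 + p) := by
    rw [hk]
    exact Nat.Coprime.pow_left k (by simp)
  let e : Equiv.Perm M := powCoprime hcop
  let σ : Equiv.Perm (Σ μ, Fin (n μ)) :=
    Equiv.sigmaCongr e fun μ => finCongr (hn μ).symm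
  have hσ : ∀ (j : ℕ) (x : Σ μ, Fin (n μ)),
      ((σ ^ j) x).1 = x.1 ^ (1 + p) ^ j ∧ (((σ ^ j) x).2 : ℕ) = x.2 := by
    intro j x
    induction j with
    | zero => exact ⟨by simp, rfl⟩
    | succ j ih =>
      rw [pow_succ', Equiv.Perm.mul_apply]
      constructor
      · show (((σ ^ j) x).1) ^ (1 + p) = _
        rw [ih.1, ← pow_mul, pow_succ]
      · exact ih.2
  have hσk : σ ^ p ^ k = 1 := by
    refine Equiv.ext fun x => ?_
    obtain ⟨h1, h2⟩ := hσ (p ^ k) x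
    have h3 : x.1 ^ (1 + p) ^ p ^ k = x.1 := by
      have hmod : (1 + p) ^ p ^ k ≡ 1 [MOD p ^ (k + 1)] := by
        have := dvd_sub_pow_of_dvd_sub (R := ℤ) (p := p) (a := 1 + p) (b := 1) (by simp) k
        rw [one_pow] at this
        exact ((Nat.modEq_iff_dvd).2 (by exact_mod_cast this)).symm
      have := pow_eq_pow_of_modEq (hmod.of_dvd (pow_dvd_pow p k.le_succ))
        (hk ▸ pow_card_eq_one' : x.1 ^ p ^ k = 1)
      rwa [pow_one] at this
    rw [h3] at h1
    refine Sigma.ext h1 ?_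
    exact (Fin.heq_ext_iff (congrArg n h1)).2 h2
  obtain ⟨x, hx⟩ := Equiv.Perm.exists_fixed_point_of_prime (by simpa using hsum) hσk
  refine ⟨x.1, ?_, fun h => ?_⟩
  · have h1 : x.1 ^ (1 + p) = x.1 := congrArg Sigma.fst hx
    rwa [pow_add, pow_one, mul_eq_left] at h1
  · exact (h ▸ x.2 : Fin 0).elim0

namespace Representation

variable {G V : Type*} [Group G] [Finite G] [AddCommGroup V] [Module ℂ V] [FiniteDimensional ℂ V]

/-- For abelian `p`-groups: invariance of the character under the `(1 + p)`-power map forces a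
weight of order dividing `p`. -/
theorem exists_weight_pow_eq_one {p : ℕ} [hp : Fact p.Prime] {A : Type*} [CommGroup A] [Finite A]
    (hA : IsPGroup p A) (ρ : Representation ℂ A V) (hV : ¬ p ∣ Module.finrank ℂ V)
    (hχ : ∀ a, ρ.character (a ^ (1 + p)) = ρ.character a) :
    ∃ μ : A →* ℂˣ, (∀ a, μ a ^ p = 1) ∧ ∃ v ∈ ρ.weightSpace μ, v ≠ 0 := by
  have := Fintype.ofFinite A
  have : NeZero ((Monoid.exponent A : ℕ) : ℂ) :=
    ⟨Nat.cast_ne_zero.2 Monoid.exponent_ne_zero_of_finite⟩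
  let _ := Fintype.ofFinite (A →* ℂˣ)
  have hA0 : (Nat.card A : ℂ) ≠ 0 := Nat.cast_ne_zero.2 Nat.card_pos.ne'
  obtain ⟨k, hk⟩ := IsPGroup.iff_card.1 hA
  have hcop : (Nat.card A).Coprime (1 + p) := by
    rw [hk]
    exact Nat.Coprime.pow_left k (by simp)
  have hM : IsPGroup p (A →* ℂˣ) := IsPGroup.iff_card.2
    ⟨k, by rw [CommGroup.card_monoidHom_of_hasEnoughRootsOfUnity, hk]⟩
  obtain ⟨μ, hμ, hμ0⟩ := exists_pow_prime_eq_one_of_sum hM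
    (fun μ => Module.finrank ℂ (ρ.weightSpace μ)) (fun μ => by
      have h : (Nat.card A : ℂ) * Module.finrank ℂ (ρ.weightSpace (μ ^ (1 + p))) =
          Nat.card A * Module.finrank ℂ (ρ.weightSpace μ) := by
        rw [card_mul_finrank_weightSpace, card_mul_finrank_weightSpace]
        refine Fintype.sum_equiv (powCoprime hcop) _ _ fun a => ?_
        rw [powCoprime_apply, hχ, map_pow, MonoidHom.pow_apply]
      exact_mod_cast mul_left_cancel₀ hA0 h)
    (by rwa [← finrank_eq_sum_weights])
  refine ⟨μ, fun a => DFunLike.congr_fun hμ a, ?_⟩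
  obtain ⟨v, hv⟩ := Submodule.exists_mem_ne_zero_of_ne_bot
    (fun h => hμ0 (Submodule.finrank_eq_zero.2 h))
  exact ⟨v, hv⟩

/-- An irreducible representation of degree prime to `p` whose character is invariant under the
`(1 + p)`-power map on a normal `p`-subgroup `P` is trivial on `Φ(P)`. -/
theorem IsIrreducible.eq_one_of_mem_frattiniIn {p : ℕ} [hp : Fact p.Prime]
    {ρ : Representation ℂ G V} (hρ : ρ.IsIrreducible) (hV : ¬ p ∣ Module.finrank ℂ V)
    {P : Subgroup G} [P.Normal] (hP : IsPGroup p P)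
    (hχ : ∀ x ∈ P, ρ.character (x ^ (1 + p)) = ρ.character x) {x : G} (hx : x ∈ frattiniIn P) :
    ρ x = 1 := by
  let σ : Representation ℂ P V := ρ.comp P.subtype
  -- `P'` acts trivially, because it fixes a common eigenvector of `P`.
  have hcomm : commutator P ≤ MonoidHom.ker σ := by
    obtain ⟨v, hv0, hv⟩ := exists_eigenvector_of_isPGroup hP σ hV
    have hfix : ∀ y ∈ (commutator P).map P.subtype, ρ y v = v := by
      rintro _ ⟨y, hy, rfl⟩
      let S : Subgroup P :=
        { carrier := {y | σ y v = v}
          mul_mem' := fun {a b} ha hb => by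
            show σ (a * b) v = v
            rw [map_mul, Module.End.mul_apply, hb, ha]
          one_mem' := by show σ 1 v = v; rw [map_one, Module.End.one_apply]
          inv_mem' := fun {a} ha => by
            show σ a⁻¹ v = v
            conv_lhs => rw [← (show σ a v = v from ha)]
            rw [inv_self_apply] }
      suffices commutator P ≤ S from this hy
      rw [commutator_eq_closure, Subgroup.closure_le]
      rintro _ ⟨a, b, rfl⟩
      obtain ⟨c, hc⟩ := hv a
      obtain ⟨d, hd⟩ := hv b
      obtain ⟨e, he⟩ := hv (b * a)⁻¹
      have hab : σ (a * b) v = σ (b * a) v := by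
        rw [map_mul, map_mul, Module.End.mul_apply, Module.End.mul_apply, hc, hd, map_smul,
          map_smul, hc, hd, smul_comm]
      show σ (a * b * a⁻¹ * b⁻¹) v = v
      rw [mul_assoc, ← mul_inv_rev, map_mul, Module.End.mul_apply, he, map_smul, hab, ← map_smul,
        ← he, self_inv_apply]
    intro y hy
    exact hρ.eq_one_of_apply_eq hv0 hfix ⟨y, hy, rfl⟩
  let τ : Representation ℂ (Abelianization P) V := QuotientGroup.lift (commutator P) σ hcomm
  have hτ : ∀ y : P, τ (Abelianization.of y) = ρ y := fun y => rfl
  obtain ⟨μ, hμ, v, hv, hv0⟩ := exists_weight_pow_eq_one (p := p)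
    (hP.of_surjective Abelianization.of QuotientGroup.mk_surjective) τ hV (by
      intro a
      obtain ⟨y, rfl⟩ := QuotientGroup.mk_surjective a
      exact hχ y y.2)
  refine hρ.eq_one_of_apply_eq (N := frattiniIn P) hv0 ?_ hx
  rintro _ ⟨y, hy, rfl⟩
  have h1 : μ (Abelianization.of y) = 1 :=
    frattini_le_ker_of_forall_pow_eq_one (μ.comp Abelianization.of) (fun y => hμ _) hy
  have h2 := hv (Abelianization.of y)
  rwa [h1, Units.val_one, one_smul, hτ] at h2

end Representation

/-! ### Degrees in the presence of a complemented abelian normal subgroup -/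

/-- The conjugation action of `K` on the linear characters of a normal subgroup `Q`:
`(k • μ) q = μ (k⁻¹ q k)`. -/
@[reducible] def conjMulActionMonoidHom {K : Type*} [Group K] (Q : Subgroup K) [Q.Normal] :
    MulAction K (Q →* ℂˣ) where
  smul k μ := μ.comp (MulAut.conjNormal k⁻¹ : MulAut Q).toMonoidHom
  one_smul μ := MonoidHom.ext fun q => by
    show μ ((MulAut.conjNormal (1 : K)⁻¹ : MulAut Q) q) = μ q
    rw [inv_one, map_one, MulAut.one_apply]
  mul_smul a b μ := MonoidHom.ext fun q => by
    show μ ((MulAut.conjNormal (a * b)⁻¹ : MulAut Q) q) =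
      μ ((MulAut.conjNormal b⁻¹ : MulAut Q) ((MulAut.conjNormal a⁻¹ : MulAut Q) q))
    rw [mul_inv_rev, map_mul, MulAut.mul_apply]

namespace Representation

section Clifford

variable {K V : Type*} [Group K] [Finite K] [AddCommGroup V] [Module ℂ V] [FiniteDimensional ℂ V]

attribute [local instance] conjMulActionMonoidHom

/-- The restriction of a representation to a subgroup. -/
abbrev resSubgroup (ρ : Representation ℂ K V) (Q : Subgroup K) : Representation ℂ Q V :=
  ρ.comp Q.subtype

omit [Finite K] [FiniteDimensional ℂ V] in
theorem apply_mem_weightSpace_smul (ρ : Representation ℂ K V) {Q : Subgroup K} [Q.Normal]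
    {μ : Q →* ℂˣ} {v : V} (hv : v ∈ (ρ.resSubgroup Q).weightSpace μ) (k : K) :
    ρ k v ∈ (ρ.resSubgroup Q).weightSpace (k • μ) := by
  intro q
  have h := hv ((MulAut.conjNormal k⁻¹ : MulAut Q) q)
  show ρ q (ρ k v) = (μ ((MulAut.conjNormal k⁻¹ : MulAut Q) q) : ℂ) • ρ k v
  rw [← map_smul, ← h]
  show _ = ρ k (ρ ((MulAut.conjNormal k⁻¹ : MulAut Q) q : K) v)
  rw [← Module.End.mul_apply, ← Module.End.mul_apply, ← map_mul, ← map_mul, MulAut.conjNormal_apply]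
  congr 2
  group

omit [Finite K] in
theorem finrank_weightSpace_smul (ρ : Representation ℂ K V) {Q : Subgroup K} [Q.Normal]
    (μ : Q →* ℂˣ) (k : K) : Module.finrank ℂ ((ρ.resSubgroup Q).weightSpace (k • μ)) =
      Module.finrank ℂ ((ρ.resSubgroup Q).weightSpace μ) := by
  have key : ∀ (μ : Q →* ℂˣ) (k : K), Module.finrank ℂ ((ρ.resSubgroup Q).weightSpace μ) ≤
      Module.finrank ℂ ((ρ.resSubgroup Q).weightSpace (k • μ)) := by
    intro μ k
    refine LinearMap.finrank_le_finrank_of_injective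
      (f := (ρ k).restrict fun v hv => ρ.apply_mem_weightSpace_smul hv k) fun v w h => ?_
    exact Subtype.ext ((ρ.apply_bijective k).1 (congrArg Subtype.val h))
  refine le_antisymm ?_ (key μ k)
  have h := key (k • μ) k⁻¹
  rwa [inv_smul_smul] at h

omit [FiniteDimensional ℂ V] in
/-- If `K = H Q`, a nonzero weight vector of an irreducible representation generates each weight
space under the elements of `H` that move its weight to the given one. -/
theorem IsIrreducible.weightSpace_le_span {ρ : Representation ℂ K V} (hρ : ρ.IsIrreducible)
    {Q H : Subgroup K} [Q.Normal] (hHQ : ∀ k : K, ∃ h ∈ H, ∃ q ∈ Q, k = h * q) {μ ν : Q →* ℂˣ}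
    {v : V} (hv : v ∈ (ρ.resSubgroup Q).weightSpace μ) (hv0 : v ≠ 0) :
    (ρ.resSubgroup Q).weightSpace ν ≤
      Submodule.span ℂ {w | ∃ h : H, (h : K) • μ = ν ∧ w = ρ h v} := by
  have := Fintype.ofFinite Q
  have hcard : (Fintype.card Q : ℂ) ≠ 0 := Nat.cast_ne_zero.2 Fintype.card_ne_zero
  -- The `H`-translates of `v` span a `K`-invariant subspace.
  have htop : Submodule.span ℂ {w | ∃ h : H, w = ρ h v} = ⊤ := by
    refine hρ.eq_top (fun k w hw => ?_) (Submodule.subset_span ⟨1, ?_⟩) hv0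
    · induction hw using Submodule.span_induction with
      | zero => rw [map_zero]; exact zero_mem _
      | add x y _ _ hx hy => rw [map_add]; exact add_mem hx hy
      | smul c x _ hx => rw [map_smul]; exact Submodule.smul_mem _ c hx
      | mem x hx =>
        obtain ⟨h, rfl⟩ := hx
        obtain ⟨h', hh', q, hq, hk⟩ := hHQ (k * h)
        rw [← Module.End.mul_apply, ← map_mul, hk, map_mul, Module.End.mul_apply,
          show ρ q v = (μ ⟨q, hq⟩ : ℂ) • v from hv ⟨q, hq⟩, map_smul]
        exact Submodule.smul_mem _ _ (Submodule.subset_span ⟨⟨h', hh'⟩, rfl⟩)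
    · simp
  -- `E` is a multiple of the projection onto the weight space of `ν`.
  let E : V →ₗ[ℂ] V := ∑ q : Q, ((ν q : ℂ))⁻¹ • ρ q
  have hE : ∀ {κ : Q →* ℂˣ} {w : V}, w ∈ (ρ.resSubgroup Q).weightSpace κ →
      E w = (∑ q : Q, (ν q : ℂ)⁻¹ * (κ q : ℂ)) • w := by
    intro κ w hw
    simp only [E, LinearMap.sum_apply, LinearMap.smul_apply, Finset.sum_smul, mul_smul]
    exact Finset.sum_congr rfl fun q _ => by rw [show ρ q w = (κ q : ℂ) • w from hw q]
  have hE0 : ∀ {κ : Q →* ℂˣ}, κ ≠ ν → ∑ q : Q, (ν q : ℂ)⁻¹ * (κ q : ℂ) = 0 := by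
    intro κ hκ
    have := sum_hom_units_eq_zero (((Units.coeHom ℂ).comp (ν⁻¹ * κ))) (fun h => hκ ?_)
    · simpa using this
    · refine MonoidHom.ext fun q => ?_
      have := DFunLike.congr_fun h q
      simp only [MonoidHom.coe_comp, Function.comp_apply, Units.coeHom_apply, MonoidHom.one_apply,
        Units.val_eq_one] at this
      exact (inv_mul_eq_one.1 (this : (ν q)⁻¹ * κ q = 1)).symm
  have hE1 : ∀ w ∈ (ρ.resSubgroup Q).weightSpace ν, E w = (Fintype.card Q : ℂ) • w := by
    intro w hw
    rw [hE hw]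
    simp
  intro w hw
  have hmem : E w ∈ Submodule.span ℂ {w | ∃ h : H, (h : K) • μ = ν ∧ w = ρ h v} := by
    have hw' : w ∈ Submodule.span ℂ {w | ∃ h : H, w = ρ h v} := htop ▸ Submodule.mem_top
    clear hw
    induction hw' using Submodule.span_induction with
    | zero => rw [map_zero]; exact zero_mem _
    | add x y _ _ hx hy => rw [map_add]; exact add_mem hx hy
    | smul c x _ hx => rw [map_smul]; exact Submodule.smul_mem _ c hx
    | mem x hx =>
      obtain ⟨h, rfl⟩ := hx
      rw [hE (ρ.apply_mem_weightSpace_smul hv h)]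
      by_cases hh : (h : K) • μ = ν
      · exact Submodule.smul_mem _ _ (Submodule.subset_span ⟨h, hh, rfl⟩)
      · rw [hE0 hh, zero_smul]; exact zero_mem _
  rw [hE1 w hw] at hmem
  exact (Submodule.smul_mem_iff _ hcard).1 hmem

/-- Itô's theorem for a normal abelian subgroup with a complement, at a single prime: the degree
is the length of an `H`-orbit of weights times the degree of an irreducible representation of
a stabilizer in `H`. -/
theorem IsIrreducible.not_dvd_finrank {ρ : Representation ℂ K V} (hρ : ρ.IsIrreducible)
    {Q H : Subgroup K} [Q.Normal] (hc : ∀ a ∈ Q, ∀ b ∈ Q, a * b = b * a)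
    (hHQ : ∀ k : K, ∃ h ∈ H, ∃ q ∈ Q, k = h * q) {p : ℕ} (hp : p.Prime)
    (hpH : ¬ p ∣ Nat.card H) : ¬ p ∣ Module.finrank ℂ V := by
  classical
  let _ : CommGroup Q :=
    { (inferInstance : Group Q) with mul_comm := fun a b => Subtype.ext (hc a a.2 b b.2) }
  have : NeZero ((Monoid.exponent Q : ℕ) : ℂ) :=
    ⟨Nat.cast_ne_zero.2 Monoid.exponent_ne_zero_of_finite⟩
  let _ := Fintype.ofFinite (Q →* ℂˣ)
  have := (isIrreducible_iff.1 hρ).1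
  let σ := ρ.resSubgroup Q
  have hsum := σ.finrank_eq_sum_weights
  obtain ⟨μ, hμ⟩ : ∃ μ : Q →* ℂˣ, Module.finrank ℂ (σ.weightSpace μ) ≠ 0 := by
    by_contra! h
    rw [Finset.sum_eq_zero fun μ _ => h μ] at hsum
    exact Module.finrank_pos.ne' hsum
  have hexists : ∀ {ν : Q →* ℂˣ}, Module.finrank ℂ (σ.weightSpace ν) ≠ 0 →
      ∃ v ∈ σ.weightSpace ν, v ≠ 0 := fun hν =>
    Submodule.exists_mem_ne_zero_of_ne_bot fun h => hν (Submodule.finrank_eq_zero.2 h)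
  obtain ⟨v, hv, hv0⟩ := hexists hμ
  -- All weights lie in one orbit.
  have horb : ∀ ν : Q →* ℂˣ, Module.finrank ℂ (σ.weightSpace ν) =
      if ν ∈ MulAction.orbit H μ then Module.finrank ℂ (σ.weightSpace μ) else 0 := by
    intro ν
    split_ifs with h
    · obtain ⟨h, rfl⟩ := h
      exact ρ.finrank_weightSpace_smul μ (h : K)
    · by_contra hν
      obtain ⟨w, hw, hw0⟩ := hexists hν
      have hspan := hρ.weightSpace_le_span hHQ hv hv0 hw
      have hempty : {w | ∃ h : H, (h : K) • μ = ν ∧ w = ρ h v} = ∅ := by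
        refine Set.eq_empty_iff_forall_notMem.2 ?_
        rintro _ ⟨k, hk, -⟩
        exact h ⟨k, hk⟩
      rw [hempty, Submodule.span_empty] at hspan
      exact hw0 hspan
  have hdim : Module.finrank ℂ V =
      Nat.card (MulAction.orbit H μ) * Module.finrank ℂ (σ.weightSpace μ) := by
    rw [hsum, Finset.sum_congr rfl fun ν _ => horb ν, ← Finset.sum_filter, Finset.sum_const,
      smul_eq_mul, Nat.card_eq_fintype_card, Fintype.card_subtype]
  -- The stabilizer acts irreducibly on the weight space.
  let T := MulAction.stabilizer H μ
  let τ : Representation ℂ T (σ.weightSpace μ) :=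
    { toFun := fun t => (ρ ((t : H) : K)).restrict fun v hv => by
        have := ρ.apply_mem_weightSpace_smul hv ((t : H) : K)
        rwa [show ((t : H) : K) • μ = μ from t.2] at this
      map_one' := LinearMap.ext fun v => Subtype.ext (by simp)
      map_mul' := fun a b => LinearMap.ext fun v => Subtype.ext (by simp) }
  have hτ : τ.IsIrreducible := by
    refine isIrreducible_iff.2 ⟨Module.nontrivial_of_finrank_pos (R := ℂ) (Nat.pos_of_ne_zero hμ),
      fun W hW => or_iff_not_imp_left.2 fun hbot => ?_⟩
    obtain ⟨w, hw, hw0⟩ := Submodule.exists_mem_ne_zero_of_ne_bot hbot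
    refine eq_top_iff.2 fun x _ => ?_
    have hx := hρ.weightSpace_le_span hHQ (μ := μ) (ν := μ) w.2 (fun h => hw0 (Subtype.ext h)) x.2
    have hle : Submodule.span ℂ {u | ∃ h : H, (h : K) • μ = μ ∧ u = ρ h w} ≤
        W.map (σ.weightSpace μ).subtype := by
      rw [Submodule.span_le]
      rintro _ ⟨h, hh, rfl⟩
      exact ⟨τ ⟨h, hh⟩ w, hW _ w hw, rfl⟩
    obtain ⟨y, hy, hyx⟩ := hle hx
    rwa [← Subtype.ext hyx]
  have hcard : Nat.card (MulAction.orbit H μ) * Nat.card T = Nat.card H := by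
    rw [← Nat.card_prod]
    exact Nat.card_congr (MulAction.orbitProdStabilizerEquivGroup H μ)
  intro hdvd
  rw [hdim] at hdvd
  rcases (Nat.Prime.dvd_mul hp).1 hdvd with h | h
  · exact hpH (h.trans (Dvd.intro _ hcard))
  · exact hpH ((hp.dvd_of_dvd_pow (h.trans hτ.finrank_dvd_card_sq)).trans (Dvd.intro_left _ hcard))

end Clifford

end Representation

/-! ### The Frattini quotient of a `p`-group -/

/-- The quotient of a finite `p`-group by a maximal subgroup is cyclic of order `p`. -/
theorem IsPGroup.pow_mem_and_commutator_mem_of_isCoatom {P : Type*} [Group P] [Finite P] {p : ℕ}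
    [hp : Fact p.Prime] (hP : IsPGroup p P) {M : Subgroup P} (hM : IsCoatom M) :
    (∀ x, x ^ p ∈ M) ∧ ∀ x y : P, (x * y) * (y * x)⁻¹ ∈ M := by
  have := hP.isNilpotent
  have : M.Normal := 
    Subgroup.NormalizerCondition.normal_of_coatom M Group.normalizerCondition_of_isNilpotent hM
  have hnt : Nontrivial (P ⧸ M) := QuotientGroup.nontrivial_iff.2 hM.1
  obtain ⟨n, hn⟩ := IsPGroup.iff_card.1 (hP.to_quotient M)
  have hn0 : n ≠ 0 := by
    rintro rfl
    exact (Finite.one_lt_card (α := P ⧸ M)).ne' (by rw [hn, pow_zero])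
  obtain ⟨z, hz⟩ := exists_prime_orderOf_dvd_card' (G := P ⧸ M) p (hn ▸ dvd_pow_self p hn0)
  -- The preimage of `⟨z⟩` lies strictly above `M`.
  have htop : Subgroup.zpowers z = ⊤ := by
    have hlt : M < (Subgroup.zpowers z).comap (QuotientGroup.mk' M) := by
      refine lt_of_le_of_ne (fun x hx => ?_) fun h => ?_
      · rw [Subgroup.mem_comap, QuotientGroup.mk'_apply, (QuotientGroup.eq_one_iff x).2 hx]
        exact one_mem _
      · obtain ⟨x, rfl⟩ := QuotientGroup.mk_surjective z
        have hx : x ∈ M := by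
          rw [h]
          exact Subgroup.mem_zpowers _
        rw [(QuotientGroup.eq_one_iff x).2 hx, orderOf_one] at hz
        exact hp.out.ne_one hz.symm
    have h := congrArg (Subgroup.map (QuotientGroup.mk' M)) (hM.2 _ hlt)
    rwa [Subgroup.map_comap_eq_self_of_surjective (QuotientGroup.mk'_surjective M),
      Subgroup.map_top_of_surjective _ (QuotientGroup.mk'_surjective M)] at h
  have hzp : ∀ w : P ⧸ M, ∃ k : ℤ, z ^ k = w := fun w =>
    Subgroup.mem_zpowers_iff.1 (htop ▸ Subgroup.mem_top w)
  refine ⟨fun x => ?_, fun x y => ?_⟩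
  · obtain ⟨k, hk⟩ := hzp x
    rw [← QuotientGroup.eq_one_iff, QuotientGroup.mk_pow, ← hk, ← zpow_natCast, ← zpow_mul,
      mul_comm, zpow_mul, zpow_natCast, ← hz, pow_orderOf_eq_one, one_zpow]
  · obtain ⟨k, hk⟩ := hzp x
    obtain ⟨l, hl⟩ := hzp y
    rw [← QuotientGroup.eq_one_iff, QuotientGroup.mk_mul, QuotientGroup.mk_inv,
      QuotientGroup.mk_mul, QuotientGroup.mk_mul, ← hk, ← hl, ← zpow_add, ← zpow_add, add_comm,
      mul_inv_cancel]

/-- For a finite `p`-group `P`, the quotient `P/Φ(P)` is elementary abelian. -/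
theorem frattiniQuotient_elementary_abelian {G : Type*} [Group G] [Finite G] {p : ℕ}
    [Fact p.Prime] {P : Subgroup G} [P.Normal] (hP : IsPGroup p P) :
    (∀ a ∈ frattiniQuotient P, ∀ b ∈ frattiniQuotient P, a * b = b * a) ∧
      ∀ q ∈ frattiniQuotient P, q ^ p = 1 := by
  have hmem : ∀ x : P, (∀ M : Subgroup P, IsCoatom M → x ∈ M) → (x : G) ∈ frattiniIn P := by
    intro x hx
    refine ⟨x, ?_, rfl⟩
    show x ∈ frattini P
    rw [frattini, Order.radical]
    simpa [Subgroup.mem_iInf] using hx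
  constructor
  · rintro _ ⟨a, ha, rfl⟩ _ ⟨b, hb, rfl⟩
    have := hmem ((⟨a, ha⟩ * ⟨b, hb⟩) * (⟨b, hb⟩ * ⟨a, ha⟩)⁻¹) fun M hM =>
      (hP.pow_mem_and_commutator_mem_of_isCoatom hM).2 _ _
    rw [← map_mul, ← map_mul, ← mul_inv_eq_one, ← map_inv, ← map_mul]
    exact (QuotientGroup.eq_one_iff _).2 this
  · rintro _ ⟨a, ha, rfl⟩
    have := hmem (⟨a, ha⟩ ^ p) fun M hM => (hP.pow_mem_and_commutator_mem_of_isCoatom hM).1 _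
    rw [← map_pow]
    exact (QuotientGroup.eq_one_iff _).2 this

theorem frattiniIn_le {G : Type*} [Group G] (P : Subgroup G) : frattiniIn P ≤ P :=
  Subgroup.map_subtype_le _

theorem index_frattiniQuotient {G : Type*} [Group G] (P : Subgroup G) [P.Normal] :
    (frattiniQuotient P).index = P.index :=
  P.index_map_eq (QuotientGroup.mk'_surjective _) (by
    rw [QuotientGroup.ker_mk']; exact frattiniIn_le P)

theorem Representation.IsIrreducible.comp_of_surjective {G G' V : Type*} [Group G] [Group G']
    [AddCommGroup V] [Module ℂ V] {ρ : Representation ℂ G' V} (hρ : ρ.IsIrreducible)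
    {f : G →* G'} (hf : Function.Surjective f) :
    Representation.IsIrreducible (ρ.comp f : Representation ℂ G V) := by
  rw [Representation.isIrreducible_iff] at hρ ⊢
  refine ⟨hρ.1, fun W hW => hρ.2 W fun g v hv => ?_⟩
  obtain ⟨g, rfl⟩ := hf g
  exact hW g v hv

/-! ### The equivalence -/

theorem theorem5p5 {G : Type*} [Group G] [Finite G] (p : ℕ) [Fact p.Prime]
    (P : Sylow p G) [(P : Subgroup G).Normal] :
    (∀ χ ∈ IrrPrimeDegree p G, pRationalityLevel p χ ≠ 1) ↔
      ∀ y ∈ frattiniQuotient (P : Subgroup G), y ≠ 1 →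
        Nonempty ((normalizerZPowers y ⧸ (centralizerOf y).subgroupOf (normalizerZPowers y)) ≃*
          MulAut (Subgroup.zpowers y)) ∧
        ActsTriviallyOnClasses (frattiniQuotient (P : Subgroup G)) y := by
  have hp : p.Prime := Fact.out
  obtain ⟨hc, hQ⟩ := frattiniQuotient_elementary_abelian P.isPGroup'
  set N := frattiniIn (P : Subgroup G) with hN
  set Q := frattiniQuotient (P : Subgroup G) with hQdef
  set m := (P : Subgroup G).index with hm
  have hm0 : m ≠ 0 := Subgroup.index_ne_zero_of_finite
  have hpm : m.Coprime p := ((hp.coprime_iff_not_dvd).2 P.not_dvd_index).symm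
  have hQm : ∀ k : G ⧸ N, k ^ m ∈ Q := fun k => by
    rw [hm, ← index_frattiniQuotient]; exact Q.pow_index_mem k
  have hKpm : ∀ k : G ⧸ N, k ^ (p * m) = 1 := fun k => by
    rw [mul_comm, pow_mul, hQ _ (hQm k)]
  obtain ⟨a, ha⟩ := IsPGroup.iff_card.1 P.isPGroup'
  -- A multiple of the exponent of `G` that is divisible by `p`, even if `P` is trivial.
  set L := p ^ (a + 1) * m with hL
  have hL0 : L ≠ 0 := mul_ne_zero (pow_ne_zero _ hp.ne_zero) hm0
  have hpmL : p * m ∣ L := mul_dvd_mul_right (dvd_pow_self p a.succ_ne_zero) m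
  have hmL : m ∣ L := dvd_mul_left m _
  have hGL : ∀ g : G, g ^ L = 1 := fun g => by
    have h : L = Nat.card G * p := by
      rw [hL, ← (P : Subgroup G).card_mul_index, ha, pow_succ]; ring
    rw [h, pow_mul, pow_card_eq_one', one_pow]
  have hfield : ∀ {n : ℕ} (ρ : Representation ℂ G (Fin n → ℂ)) {d : ℕ}, d ∣ L →
      (fieldOfValues ρ.character ≤ cyclotomicSubfield d ↔
      ∀ u : ℕ, u.Coprime L → u ≡ 1 [MOD d] → ∀ g, ρ.character (g ^ u) = ρ.character g) :=
    fun ρ d hd => fieldOfValues_le_cyclotomicSubfield_iff hL0 hd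
      (ρ.exists_character_pow_eq_sum hGL)
  have hlevel : ∀ {n : ℕ} (ρ : Representation ℂ G (Fin n → ℂ)),
      pRationalityLevel p ρ.character = 1 ↔ fieldOfValues ρ.character ≤ cyclotomicSubfield (p * m) ∧
        ¬ fieldOfValues ρ.character ≤ cyclotomicSubfield m := fun ρ =>
    pRationalityLevel_eq_one_iff (a := a + 1) hpm hm0 ((hfield ρ dvd_rfl).2 fun u _ hu g => by
      rw [pow_eq_pow_of_modEq hu (hGL g), pow_one])
  rw [← forall_conj_pow_iff_forall_mulAut hc hp hpm hQ hQm, ← forall_isConj_pow_iff hpm hQ hQm]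
  constructor
  · intro H g u hup hum
    have huL : u.Coprime L := by
      refine Nat.Coprime.mul_right (hup.pow_right _) ?_
      rw [Nat.coprime_iff_gcd_eq_one, hum.gcd_eq, Nat.gcd_one_left]
    refine Representation.isConj_of_forall_isIrrChar ?_
    rintro _ ⟨n, σ, hσ, rfl⟩
    let ρ : Representation ℂ G (Fin n → ℂ) := σ.comp (QuotientGroup.mk' N)
    have hρ : ρ.IsIrreducible := hσ.comp_of_surjective (QuotientGroup.mk'_surjective N)
    -- `Q` has a complement, so all irreducible characters of `G/Φ(P)` have degree prime to `p`.
    have hdeg : ¬ p ∣ n := by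
      have hidx : Q.index = m := index_frattiniQuotient _
      have hcard : (Nat.card Q).Coprime Q.index := by
        obtain ⟨b, hb⟩ := IsPGroup.iff_card.1 (P.isPGroup'.map (QuotientGroup.mk' N))
        rw [hidx, hQdef, frattiniQuotient, hb]
        exact hpm.symm.pow_left b
      obtain ⟨H, hH⟩ := Subgroup.exists_right_complement'_of_coprime hcard
      have h := hσ.not_dvd_finrank (H := H) hc (fun k => ?_) hp (by
        rw [← hH.symm.index_eq_card, hidx]; exact P.not_dvd_index)
      · simpa using h
      · obtain ⟨⟨h, q⟩, hk⟩ := hH.symm.surjective k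
        exact ⟨h, h.2, q, q.2, hk.symm⟩
    have h1 := H ρ.character ⟨⟨n, ρ, hρ, rfl⟩, n, by simp, hdeg⟩
    rw [Ne, hlevel, not_and_not_right] at h1
    have h2 := h1 ((hfield ρ hpmL).2 fun u _ hu g => by
      show σ.character (QuotientGroup.mk' N (g ^ u)) = σ.character (QuotientGroup.mk' N g)
      rw [map_pow, pow_eq_pow_of_modEq hu (hKpm _), pow_one])
    obtain ⟨g, rfl⟩ := QuotientGroup.mk'_surjective N g
    have h3 := (hfield ρ hmL).1 h2 u huL hum g
    rw [← map_pow]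
    exact h3.symm
  · rintro H _ ⟨⟨n, ρ, hρ, rfl⟩, d, hd, hpd⟩ hlev
    obtain ⟨hle, hnle⟩ := (hlevel ρ).1 hlev
    have hdim : ¬ p ∣ Module.finrank ℂ (Fin n → ℂ) := by
      rw [Representation.char_one] at hd
      rwa [Nat.cast_injective hd]
    -- The character is invariant under `x ↦ x ^ (1 + p)` on `P`, so it is a character of `G/Φ(P)`.
    have htriv : ∀ x ∈ N, ρ x = 1 := fun x hx =>
      hρ.eq_one_of_mem_frattiniIn hdim P.isPGroup' (fun x hx => by
        obtain ⟨u, hu1, hu2⟩ := Nat.chineseRemainder (hpm.symm.pow_left (a + 1)) (1 + p) 1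
        have huL : u.Coprime L := by
          refine Nat.Coprime.mul_right ?_ ?_
          · rw [Nat.coprime_iff_gcd_eq_one, hu1.gcd_eq]
            exact Nat.Coprime.pow_right _ (by simp)
          · rw [Nat.coprime_iff_gcd_eq_one, hu2.gcd_eq, Nat.gcd_one_left]
        have hup : u ≡ 1 [MOD p] :=
          (hu1.of_dvd (dvd_pow_self p a.succ_ne_zero)).trans (by simp [Nat.ModEq])
        have hupm : u ≡ 1 [MOD p * m] :=
          (Nat.modEq_and_modEq_iff_modEq_mul hpm.symm).1 ⟨hup, hu2⟩
        have hxp : x ^ p ^ (a + 1) = 1 := by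
          have : (⟨x, hx⟩ : (P : Subgroup G)) ^ p ^ a = 1 := ha ▸ pow_card_eq_one'
          rw [pow_succ, pow_mul, show x ^ p ^ a = 1 from congrArg Subtype.val this, one_pow]
        rw [← pow_eq_pow_of_modEq hu1 hxp]
        exact (hfield ρ hpmL).1 hle u huL hupm x) hx
    refine hnle ((hfield ρ hmL).2 fun u huL hum g => ?_)
    obtain ⟨k, hk⟩ := isConj_iff.1 (H (QuotientGroup.mk g) u
      (huL.coprime_dvd_right ((dvd_mul_right p m).trans hpmL)) hum)
    obtain ⟨k, rfl⟩ := QuotientGroup.mk_surjective k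
    have hmem : (k * g * k⁻¹)⁻¹ * g ^ u ∈ N := QuotientGroup.eq.1 hk
    have hρu : ρ (g ^ u) = ρ (k * g * k⁻¹) := by
      rw [← mul_inv_cancel_left (k * g * k⁻¹) (g ^ u), map_mul, htriv _ hmem, mul_one]
    rw [← ρ.char_conj g k, Representation.character, hρu, Representation.character]
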